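/- Let $n\in\mathbb N$, $h,\vartheta>0$ and $I\in\mathbb N$ with $\vartheta=Ih$. A function is piecewise Lipschitz on $[a,b)$ (or on $[a,b]$) if there are points $a=\xi_1<\dots<\xi_k=b$ such that it is Lipschitz continuous on each $[\xi_i,\xi_{i+1})$. Let $\mathrm{PLip}$ be the set of piecewise Lipschitz functions $w:[-h,0)\to\mathbb R^n$, $\mathrm{Lip}\subset\mathrm{PLip}$ the set of Lipschitz continuous ones, and $\mathrm C^1\subset\mathrm{Lip}$ the set of those $w\in\mathrm{Lip}$ that are continuously differentiable on $[-h,0)$ (one-sidedly at $-h$). Write $\|w\|_1=\int_{-h}^0\|w(\xi)\|\,d\xi$, $\|w\|_\infty=\sup_{[-h,0)}\|w\|$, $w(-0)=\lim_{\xi\uparrow0}w(\xi)$, $x_t(\xi)=x(t+\xi)$ for $\xi\in[-h,0)$, $P(\alpha)=\{(z,w)\in\mathbb R^n\times\mathrm{PLip}:\|z\|\le\alpha,\ \|w\|_\infty\le\alpha\}$, and $\mathbb G=[0,\vartheta]\times\mathbb R^n\times\mathrm{PLip}$. Let $g:[0,\vartheta]\times\mathbb R^n\to\mathbb R^n$ be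 continuously differentiable, let $H:[0,\vartheta]\times\mathbb R^n\times\mathbb R^n\times\mathbb R^n\to\mathbb R$ be continuous, and let $\sigma:\mathbb R^n\times\mathrm{PLip}\to\mathbb R$. Assume that $$|H(\tau,z,r,s)-H(\tau,z,r,s')|\le c_H(1+\|z\|+\|r\|)\|s-s'\|$$ for a constant $c_H>0$ and all $\tau\in[0,\vartheta]$ and $z,r,s,s'\in\mathbb R^n$; that for every $\alpha>0$ there is $\lambda_H>0$ with $$|H(\tau,z,r,s)-H(\tau,z',r',s)|\le\lambda_H(\|z-z'\|+\|r-r'\|)(1+\|s\|)$$ for all $\tau\in[0,\vartheta]$, all $z,r,z',r'$ of norm at most $\alpha$ and all $s\in\mathbb R^n$; and that for every $\alpha>0$ there is $\lambda_\sigma>0$ with $$|\sigma(z,w)-\sigma(z',w')|\le\lambda_\sigma(\|z-z'\|+\|w-w'\|_1)$$ for all $(z,w),(z',w')\in P(\alpha)$. For $(\tau,z,w)\in\mathbb G$ and $\eta\in[0,1]$ let $X^\eta(\tau,z,w)$ be the set of piecewise Lipschitz $x:[\tau-h,\vartheta]\to\mathbb R^n$ with $x(\tau)=z$ and $x_\tau=w$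 such that $y(t)=x(t)-g(t,x(t-h))$ is Lipschitz continuous on $[\tau,\vartheta]$ and $\|y'(t)\|\le c_H(1+\|x(t)\|+\|x(t-h)\|)+\eta$ for a.e. $t\in[\tau,\vartheta]$. With this $y$, put $$\omega(\tau,t,x,s)=\int_\tau^tH(\xi,x(\xi),x(\xi-h),s)\,d\xi-\langle y(t)-y(\tau),s\rangle .$$ For $\varphi:\mathbb G\to\mathbb R$ consider the pair of inequalities $$\inf_{x\in X^\eta(\tau,z,w)}\big(\varphi(t,x(t),x_t)+\omega(\tau,t,x,s)\big)\le\varphi(\tau,z,w)\le\sup_{x\in X^\eta(\tau,z,w)}\big(\varphi(t,x(t),x_t)+\omega(\tau,t,x,s)\big),\qquad(\ast)$$ and the conditions * $(\varphi_1)$ for each $(\tau,w)\in[0,\vartheta]\times\mathrm{Lip}$ the function $t\mapsto\varphi(t,w(-0),w)$ is continuous on $[\tau,\vartheta]$; * $(\varphi_2)$ for every $\alpha>0$ there is $\lambda_\varphi>0$ such that $$|\varphi(\tau,z,w)-\varphi(\tau,z',w')|\le\lambda_\varphi\big(\|z-z'\|+\|w-w'\|_1+\|(w-w')(-h)\|+\|(w-w')(ih-\tau)\|\big)$$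 for all $\tau\in[0,\vartheta]$ and $(z,w),(z',w')\in P(\alpha)$, where $i\in\{-1,\dots,I-1\}$ is such that $\tau\in(ih,(i+1)h]$. **Theorem.** For every functional $\varphi:\mathbb G\to\mathbb R$ the following statements are equivalent. * (a) $\varphi$ is a minimax solution: $(\varphi_1)$ and $(\varphi_2)$ hold, $\varphi(\vartheta,z,w)=\sigma(z,w)$ for all $(z,w)\in\mathbb R^n\times\mathrm{PLip}$, and $(\ast)$ holds with $\eta=0$ for all $(\tau,z,w)\in\mathbb G$ with $\tau<\vartheta$, all $t\in(\tau,\vartheta]$ and all $s\in\mathbb R^n$. * (b) $\varphi$ is a $\mathrm{Lip}$-minimax solution: $(\varphi_1)$ and $(\varphi_2)$ hold, $\varphi(\vartheta,w(-0),w)=\sigma(w(-0),w)$ for all $w\in\mathrm{Lip}$, and $(\ast)$ holds with $z=w(-0)$ and $\eta=0$ for all $(\tau,w)\in[0,\vartheta)\times\mathrm{Lip}$, all $t\in(\tau,\vartheta]$ and all $s\in\mathbb R^n$. * (c) $\varphi$ is a $\mathrm C^1$-minimax solution: $(\varphi_1)$ and $(\varphi_2)$ hold, $\varphi(\vartheta,w(-0),w)=\sigma(w(-0),w)$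 for all $w\in\mathrm C^1$, and $(\ast)$ holds with $z=w(-0)$ for all $i\in\{0,\dots,I-1\}$, $(\tau,w)\in[ih,(i+1)h)\times\mathrm C^1$, $t\in(\tau,(i+1)h]$, $s\in\mathbb R^n$ and $\eta\in(0,1]$. -/

import Mathlib

open Set MeasureTheory

noncomputable section

namespace NeutralHJ

/-- The Euclidean space `ℝⁿ`. -/
abbrev Rn (n : ℕ) : Type := EuclideanSpace ℝ (Fin n)

/-- Functions `w : [-h, 0) → ℝⁿ`. -/
abbrev Hist (h : ℝ) (n : ℕ) : Type := Ico (-h) (0 : ℝ) → Rn n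

/-- `w` read as a function of a real variable (the value `0` outside `[-h, 0)` is never used). -/
def ext {h : ℝ} {n : ℕ} (w : Hist h n) (ξ : ℝ) : Rn n :=
  open Classical in if hξ : ξ ∈ Ico (-h) (0 : ℝ) then w ⟨ξ, hξ⟩ else 0

/-- Piecewise Lipschitz continuity on `[a, b)` or on `[a, b]` (the condition is the same; the value
at `b` is not restricted): there are `a = p₀ < p₁ < ⋯ < pₖ = b` such that `x` is Lipschitz
continuous on each `[pᵢ, pᵢ₊₁)`. -/
def PiecewiseLip {n : ℕ} (a b : ℝ) (x : ℝ → Rn n) : Prop :=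
  ∃ (k : ℕ) (p : ℕ → ℝ), p 0 = a ∧ p k = b ∧ (∀ i < k, p i < p (i + 1)) ∧
    ∀ i < k, ∃ K : NNReal, LipschitzOnWith K x (Ico (p i) (p (i + 1)))

/-- The space `PLip` of piecewise Lipschitz continuous functions on `[-h, 0)`. -/
def PLip {h : ℝ} {n : ℕ} : Set (Hist h n) := {w | PiecewiseLip (-h) 0 (ext w)}

/-- The space `Lip` of Lipschitz continuous functions on `[-h, 0)`. -/
def Lip {h : ℝ} {n : ℕ} : Set (Hist h n) := {w | ∃ K : NNReal, LipschitzWith K w}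

/-- The space `C¹` of Lipschitz continuous functions on `[-h, 0)` that are continuously
differentiable on `[-h, 0)` (one-sidedly at `-h`). -/
def C1 {h : ℝ} {n : ℕ} : Set (Hist h n) :=
  {w | w ∈ Lip ∧ ContDiffOn ℝ 1 (ext w) (Ico (-h) 0)}

/-- `w(-0)`, the left limit of `w` at `0`. -/
def endLim {h : ℝ} {n : ℕ} (w : Hist h n) : Rn n := Function.leftLim (ext w) 0

/-- `‖w‖₁`, the integral of `‖w(ξ)‖` over `[-h, 0)`. -/
def norm1 {h : ℝ} {n : ℕ} (w : Hist h n) : ℝ := ∫ ξ in Ico (-h) (0 : ℝ), ‖ext w ξ‖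

/-- The set `P(α)` of pairs `(z, w)` in `ℝⁿ × PLip` with `‖z‖ ≤ α` and `‖w‖_∞ ≤ α`. -/
def P {h : ℝ} {n : ℕ} (α : ℝ) : Set (Rn n × Hist h n) :=
  {q | q.2 ∈ PLip ∧ ‖q.1‖ ≤ α ∧ ∀ ξ, ‖q.2 ξ‖ ≤ α}

/-- The history segment `x_t(ξ) = x(t + ξ)`, `ξ ∈ [-h, 0)`. -/
def seg {n : ℕ} (h : ℝ) (x : ℝ → Rn n) (t : ℝ) : Hist h n := fun ξ => x (t + ξ)

/-! ### Conditions on `g`, `H`, `σ` -/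

/-- `g` is continuously differentiable on `[0, ϑ] × ℝⁿ`. -/
def CondG {n : ℕ} (ϑ : ℝ) (g : ℝ → Rn n → Rn n) : Prop :=
  ContDiffOn ℝ 1 (fun q : ℝ × Rn n => g q.1 q.2) (Icc 0 ϑ ×ˢ univ)

/-- `H` is continuous on `[0, ϑ] × ℝⁿ × ℝⁿ × ℝⁿ`. -/
def CondH1 {n : ℕ} (ϑ : ℝ) (H : ℝ → Rn n → Rn n → Rn n → ℝ) : Prop :=
  ContinuousOn (fun q : ℝ × Rn n × Rn n × Rn n => H q.1 q.2.1 q.2.2.1 q.2.2.2) (Icc 0 ϑ ×ˢ univ)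

/-- Lipschitz continuity of `H` in the last variable, with the constant `cH`. -/
def CondH2 {n : ℕ} (ϑ cH : ℝ) (H : ℝ → Rn n → Rn n → Rn n → ℝ) : Prop :=
  ∀ τ ∈ Icc 0 ϑ, ∀ z r s s' : Rn n, |H τ z r s - H τ z r s'| ≤ cH * (1 + ‖z‖ + ‖r‖) * ‖s - s'‖

/-- Local Lipschitz continuity of `H` in the two state variables. -/
def CondH3 {n : ℕ} (ϑ : ℝ) (H : ℝ → Rn n → Rn n → Rn n → ℝ) : Prop :=
  ∀ α > 0, ∃ lam > 0, ∀ τ ∈ Icc 0 ϑ, ∀ z r z' r' s : Rn n,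
    ‖z‖ ≤ α → ‖r‖ ≤ α → ‖z'‖ ≤ α → ‖r'‖ ≤ α →
      |H τ z r s - H τ z' r' s| ≤ lam * (‖z - z'‖ + ‖r - r'‖) * (1 + ‖s‖)

/-- Local Lipschitz continuity of the terminal functional `σ`. -/
def CondSigma {h : ℝ} {n : ℕ} (σ : Rn n → Hist h n → ℝ) : Prop :=
  ∀ α > 0, ∃ lam > 0, ∀ (z z' : Rn n) (w w' : Hist h n), (z, w) ∈ P α → (z', w') ∈ P α →
    |σ z w - σ z' w'| ≤ lam * (‖z - z'‖ + norm1 (w - w'))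

/-! ### Conditions on `φ`

A functional `φ` on `[0, ϑ] × ℝⁿ × PLip` is given by a function whose values for `τ ∉ [0, ϑ]` or
`w ∉ PLip` are irrelevant. -/

/-- For `(τ, w) ∈ [0, ϑ] × Lip`, the function `t ↦ φ(t, w(-0), w)` is continuous on `[τ, ϑ]`. -/
def CondPhi1 {h : ℝ} {n : ℕ} (ϑ : ℝ) (φ : ℝ → Rn n → Hist h n → ℝ) : Prop :=
  ∀ τ ∈ Icc 0 ϑ, ∀ w ∈ Lip, ContinuousOn (fun t => φ t (endLim w) w) (Icc τ ϑ)

/-- `υ(τ, z, w) = ‖z‖ + ‖w‖₁ + ‖w(-h)‖ + ‖w(ih - τ)‖`, to be used for `τ ∈ (ih, (i+1)h]`. -/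
def upsilon {h : ℝ} {n : ℕ} (i : ℤ) (τ : ℝ) (z : Rn n) (w : Hist h n) : ℝ :=
  ‖z‖ + norm1 w + ‖ext w (-h)‖ + ‖ext w (i * h - τ)‖

/-- The local Lipschitz condition on `φ` with respect to `υ`. -/
def CondPhi2 {h : ℝ} {n : ℕ} (N : ℕ) (ϑ : ℝ) (φ : ℝ → Rn n → Hist h n → ℝ) : Prop :=
  ∀ α > 0, ∃ lam > 0, ∀ τ ∈ Icc 0 ϑ, ∀ i : ℤ, -1 ≤ i → i ≤ (N : ℤ) - 1 →
    τ ∈ Ioc (i * h) ((i + 1) * h) →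
    ∀ (z z' : Rn n) (w w' : Hist h n), (z, w) ∈ P α → (z', w') ∈ P α →
      |φ τ z w - φ τ z' w'| ≤ lam * upsilon i τ (z - z') (w - w')

/-! ### Characteristic neutral-type inclusions -/

/-- `Λ(τ, z, w)`: functions `x ∈ PLip([τ - h, ϑ], ℝⁿ)` with `x(τ) = z` and `x(t) = w(t - τ)` for
`t ∈ [τ - h, τ)`. Only the values on `[τ - h, ϑ]` matter. -/
def Lam {h : ℝ} {n : ℕ} (ϑ τ : ℝ) (z : Rn n) (w : Hist h n) : Set (ℝ → Rn n) :=
  {x | PiecewiseLip (τ - h) ϑ x ∧ x τ = z ∧ seg h x τ = w}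

/-- `F^η(x, y)`, the closed ball of radius `cH (1 + ‖x‖ + ‖y‖) + η` centred at the origin. -/
def F {n : ℕ} (cH η : ℝ) (x y : Rn n) : Set (Rn n) := {l | ‖l‖ ≤ cH * (1 + ‖x‖ + ‖y‖) + η}

/-- `y(t) = x(t) - g(t, x(t - h))`. -/
def neutral {n : ℕ} (h : ℝ) (g : ℝ → Rn n → Rn n) (x : ℝ → Rn n) (t : ℝ) : Rn n :=
  x t - g t (x (t - h))

/-- `X^η(τ, z, w)`: the `x ∈ Λ(τ, z, w)` for which `y(t) = x(t) - g(t, x(t - h))` is Lipschitz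
continuous on `[τ, ϑ]` and satisfies `y'(t) ∈ F^η(x(t), x(t - h))` for a.e. `t ∈ [τ, ϑ]`. -/
def X {h : ℝ} {n : ℕ} (ϑ cH : ℝ) (g : ℝ → Rn n → Rn n) (η τ : ℝ) (z : Rn n) (w : Hist h n) :
    Set (ℝ → Rn n) :=
  {x | x ∈ Lam ϑ τ z w ∧ (∃ K : NNReal, LipschitzOnWith K (neutral h g x) (Icc τ ϑ)) ∧
    ∀ᵐ t : ℝ, t ∈ Icc τ ϑ →
      ∃ l ∈ F cH η (x t) (x (t - h)), HasDerivWithinAt (neutral h g x) l (Icc τ ϑ) t}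

/-- `ω(τ, t, x, s) = ∫_τ^t H(ξ, x(ξ), x(ξ - h), s) dξ - ⟨y(t) - y(τ), s⟩`. -/
def omega {n : ℕ} (h : ℝ) (g : ℝ → Rn n → Rn n) (H : ℝ → Rn n → Rn n → Rn n → ℝ)
    (τ t : ℝ) (x : ℝ → Rn n) (s : Rn n) : ℝ :=
  (∫ ξ in τ..t, H ξ (x ξ) (x (ξ - h)) s) - inner ℝ (neutral h g x t - neutral h g x τ) s

/-- The upper inequality: the infimum (in the extended reals) over `X^η(τ, z, w)` of
`φ(t, x(t), x_t) + ω(τ, t, x, s)` is at most `φ(τ, z, w)`. -/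
def UpperIneq {h : ℝ} {n : ℕ} (ϑ cH : ℝ) (g : ℝ → Rn n → Rn n) (H : ℝ → Rn n → Rn n → Rn n → ℝ)
    (φ : ℝ → Rn n → Hist h n → ℝ) (η τ : ℝ) (z : Rn n) (w : Hist h n) (t : ℝ) (s : Rn n) : Prop :=
  (⨅ x ∈ X ϑ cH g η τ z w, ((φ t (x t) (seg h x t) + omega h g H τ t x s : ℝ) : EReal)) ≤
    ((φ τ z w : ℝ) : EReal)

/-- The lower inequality: the supremum (in the extended reals) over `X^η(τ, z, w)` of
`φ(t, x(t), x_t) + ω(τ, t, x, s)` is at least `φ(τ, z, w)`. -/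
def LowerIneq {h : ℝ} {n : ℕ} (ϑ cH : ℝ) (g : ℝ → Rn n → Rn n) (H : ℝ → Rn n → Rn n → Rn n → ℝ)
    (φ : ℝ → Rn n → Hist h n → ℝ) (η τ : ℝ) (z : Rn n) (w : Hist h n) (t : ℝ) (s : Rn n) : Prop :=
  ((φ τ z w : ℝ) : EReal) ≤
    ⨆ x ∈ X ϑ cH g η τ z w, ((φ t (x t) (seg h x t) + omega h g H τ t x s : ℝ) : EReal)

/-! ### The three notions of solution -/

/-- Minimax solution. -/
structure IsMinimaxSolution {h : ℝ} {n : ℕ} (N : ℕ) (ϑ cH : ℝ) (g : ℝ → Rn n → Rn n)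
    (H : ℝ → Rn n → Rn n → Rn n → ℝ) (σ : Rn n → Hist h n → ℝ)
    (φ : ℝ → Rn n → Hist h n → ℝ) : Prop where
  phi1 : CondPhi1 ϑ φ
  phi2 : CondPhi2 N ϑ φ
  terminal : ∀ (z : Rn n), ∀ w ∈ PLip, φ ϑ z w = σ z w
  ineq : ∀ τ ∈ Ico 0 ϑ, ∀ (z : Rn n), ∀ w ∈ PLip, ∀ t ∈ Ioc τ ϑ, ∀ s : Rn n,
    UpperIneq ϑ cH g H φ 0 τ z w t s ∧ LowerIneq ϑ cH g H φ 0 τ z w t s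

/-- `Lip`-minimax solution. -/
structure IsLipMinimaxSolution {h : ℝ} {n : ℕ} (N : ℕ) (ϑ cH : ℝ) (g : ℝ → Rn n → Rn n)
    (H : ℝ → Rn n → Rn n → Rn n → ℝ) (σ : Rn n → Hist h n → ℝ)
    (φ : ℝ → Rn n → Hist h n → ℝ) : Prop where
  phi1 : CondPhi1 ϑ φ
  phi2 : CondPhi2 N ϑ φ
  terminal : ∀ w ∈ Lip, φ ϑ (endLim w) w = σ (endLim w) w
  ineq : ∀ τ ∈ Ico 0 ϑ, ∀ w ∈ Lip, ∀ t ∈ Ioc τ ϑ, ∀ s : Rn n,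
    UpperIneq ϑ cH g H φ 0 τ (endLim w) w t s ∧ LowerIneq ϑ cH g H φ 0 τ (endLim w) w t s

/-- `C¹`-minimax solution. -/
structure IsC1MinimaxSolution {h : ℝ} {n : ℕ} (N : ℕ) (ϑ cH : ℝ) (g : ℝ → Rn n → Rn n)
    (H : ℝ → Rn n → Rn n → Rn n → ℝ) (σ : Rn n → Hist h n → ℝ)
    (φ : ℝ → Rn n → Hist h n → ℝ) : Prop where
  phi1 : CondPhi1 ϑ φ
  phi2 : CondPhi2 N ϑ φ
  terminal : ∀ w ∈ C1, φ ϑ (endLim w) w = σ (endLim w) w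
  ineq : ∀ i < N, ∀ τ ∈ Ico (i * h) ((i + 1) * h), ∀ w ∈ C1, ∀ t ∈ Ioc τ ((i + 1) * h),
    ∀ s : Rn n, ∀ η ∈ Ioc (0 : ℝ) 1,
    UpperIneq ϑ cH g H φ η τ (endLim w) w t s ∧ LowerIneq ϑ cH g H φ η τ (endLim w) w t s

end NeutralHJ

end

/-!
The implications from minimax to `Lip`-minimax and from `Lip`-minimax to `C¹`-minimax solutions hold
because `C¹ ⊆ Lip ⊆ PLip` and because `X^0 ⊆ X^η` makes both inequalities weaker.

For the way back, let `τ ∈ [ih, (i+1)h)`, `t ≤ (i+1)h` and `(z, w)` with `w ∈ PLip` be given. The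
history `w`, extended by `z` to the right of `0`, is right-continuous, so averaging it forward
twice yields `C¹` histories that end exactly at `z`, are uniformly bounded and converge to `w` at
every point of `[-h, 0)` (`exists_C1_approx`). Pointwise convergence at every point controls all
the terms of `υ`, including the point evaluations, so `φ(τ, ·)` passes to the limit
(`CondPhi2.tendsto`), and so does `σ`, which gives the terminal condition.

The `C¹` hypothesis with `η = 1/(k+1)` supplies trajectories `x_k` that realize the inequality up to
`1/(k+1)`. Since `t ≤ τ + h`, their delayed arguments only see the initial data, so Gronwall's
inequality bounds `y_k = x_k - g(·, x_k(· - h))` and makes it equi-Lipschitz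
(`exists_uniform_bounds`). By Arzelà–Ascoli a subsequence of `y_k` converges, hence `x_k` converges
at every point of `[τ - h, t]`. The differential inclusion is equivalent to the increment
bound `‖y(b) - y(a)‖ ≤ ∫ₐᵇ (cH (1 + ‖x‖ + ‖x(· - h)‖) + η)` (`mem_X_iff`), which survives pointwise
limits; so the limit belongs to `X^0(τ, z, w)` (`exists_subseq_limit`) and, by dominated
convergence in `ω`, realizes the inequality exactly (`exists_trajectory_of_C1`). Concatenating such
trajectories over successive intervals `[ih, (i+1)h]` reaches every `t ≤ ϑ`
(`exists_trajectory_of_one_step`). The upper and lower inequalities are handled together through a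
factor `c = ±1`.
-/

open Filter Topology

namespace NeutralHJ

variable {n : ℕ}

/-! ### Piecewise Lipschitz functions -/

namespace PiecewiseLip

variable {a b c : ℝ} {x : ℝ → Rn n}

theorem refl (a : ℝ) (x : ℝ → Rn n) : PiecewiseLip a a x :=
  ⟨0, fun _ => a, rfl, rfl, by simp, by simp⟩

theorem cons {K : NNReal} (hac : a < c) (hK : LipschitzOnWith K x (Ico a c))
    (hcb : PiecewiseLip c b x) : PiecewiseLip a b x := by
  obtain ⟨k, p, hp0, hpk, hlt, hL⟩ := hcb
  refine ⟨k + 1, fun i => Nat.casesOn i a p, rfl, hpk, ?_, ?_⟩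
  · rintro (_ | i) hi
    · simpa [hp0] using hac
    · exact hlt i (by omega)
  · rintro (_ | i) hi
    · exact ⟨K, by simpa [hp0] using hK⟩
    · exact hL i (by omega)

/-- Induction over the pieces of a piecewise Lipschitz function, from the right end to the left. -/
theorem piece_induction {motive : ℝ → Prop} (base : motive b)
    (step : ∀ (a c : ℝ) (K : NNReal), a < c → c ≤ b → PiecewiseLip c b x →
      LipschitzOnWith K x (Ico a c) → motive c → motive a)
    (hx : PiecewiseLip a b x) : motive a := by
  obtain ⟨k, p, hp0, hpk, hlt, hL⟩ := hx
  have key : ∀ j, ∀ i, i + j = k → p i ≤ b ∧ PiecewiseLip (p i) b x ∧ motive (p i) := by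
    intro j
    induction j with
    | zero =>
      rintro i rfl
      simp only [Nat.add_zero] at hpk
      rw [hpk]
      exact ⟨le_rfl, refl b x, base⟩
    | succ j ih =>
      intro i hi
      obtain ⟨h1, h2, h3⟩ := ih (i + 1) (by omega)
      have hlt' := hlt i (by omega)
      obtain ⟨K, hK⟩ := hL i (by omega)
      exact ⟨hlt'.le.trans h1, cons hlt' hK h2, step _ _ K hlt' h1 h2 hK h3⟩
  simpa [hp0] using (key k 0 (by simp)).2.2

theorem le (hx : PiecewiseLip a b x) : a ≤ b :=
  piece_induction (motive := fun a => a ≤ b) le_rfl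
    (fun _ _ _ h1 h2 _ _ _ => h1.le.trans h2) hx

theorem of_lipschitzOnWith {K : NNReal} (hab : a ≤ b) (hK : LipschitzOnWith K x (Ico a b)) :
    PiecewiseLip a b x := by
  rcases hab.eq_or_lt with rfl | hab
  · exact refl a x
  · exact cons hab hK (refl b x)

theorem trans (hx : PiecewiseLip a b x) (hx' : PiecewiseLip b c x) : PiecewiseLip a c x :=
  piece_induction (motive := fun a => PiecewiseLip a c x) hx'
    (fun _ _ _ h1 _ _ hK h => cons h1 hK h) hx

theorem restrict_left (hx : PiecewiseLip a b x) (hac : a ≤ c) (hcb : c ≤ b) :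
    PiecewiseLip a c x := by
  refine piece_induction (motive := fun a => a ≤ c → PiecewiseLip a c x) ?_ ?_ hx hac
  · intro h
    obtain rfl := le_antisymm h hcb
    exact refl _ x
  · intro a d K had _ _ hK ih hac
    rcases le_total d c with h | h
    · exact cons had hK (ih h)
    · exact of_lipschitzOnWith hac (hK.mono (Ico_subset_Ico_right h))

theorem restrict_right (hx : PiecewiseLip a b x) (hac : a ≤ c) (hcb : c ≤ b) :
    PiecewiseLip c b x := by
  refine piece_induction (motive := fun a => a ≤ c → PiecewiseLip c b x) ?_ ?_ hx hac
  · intro h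
    obtain rfl := le_antisymm h hcb
    exact refl _ x
  · intro a d K had _ hd hK ih hac
    rcases le_or_gt d c with h | h
    · exact ih h
    · exact cons h (hK.mono (Ico_subset_Ico_left hac)) hd

/-- A transformation that preserves Lipschitz continuity on subintervals preserves piecewise
Lipschitz continuity. -/
theorem map {x' : ℝ → Rn n}
    (hx : PiecewiseLip a b x)
    (hmap : ∀ (c d : ℝ) (K : NNReal), a ≤ c → d ≤ b → LipschitzOnWith K x (Ico c d) →
      ∃ K' : NNReal, LipschitzOnWith K' x' (Ico c d)) : PiecewiseLip a b x' := by
  refine piece_induction (motive := fun e => a ≤ e → PiecewiseLip e b x') ?_ ?_ hx le_rfl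
  · intro _
    exact refl _ _
  · intro e d K h1 h2 _ hK ih hae
    obtain ⟨K', hK'⟩ := hmap e d K hae h2 hK
    exact cons h1 hK' (ih (hae.trans h1.le))

theorem congr {x' : ℝ → Rn n} (hx : PiecewiseLip a b x) (heq : EqOn x x' (Ico a b)) :
    PiecewiseLip a b x' :=
  hx.map fun c d K hc hd hK => ⟨K, by
    intro s hs t ht
    rw [← heq ⟨hc.trans hs.1, hs.2.trans_le hd⟩, ← heq ⟨hc.trans ht.1, ht.2.trans_le hd⟩]
    exact hK hs ht⟩

theorem shift (hx : PiecewiseLip a b x) (s : ℝ) :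
    PiecewiseLip (a + s) (b + s) (fun t => x (t - s)) := by
  refine piece_induction (motive := fun a => PiecewiseLip (a + s) (b + s) (fun t => x (t - s)))
    (refl _ _) ?_ hx
  intro a c K h1 _ _ hK ih
  refine cons (c := c + s) (K := K) (by linarith) ?_ ih
  intro u hu v hv
  have := hK (x := u - s) ⟨by linarith [hu.1], by linarith [hu.2]⟩
    (y := v - s) ⟨by linarith [hv.1], by linarith [hv.2]⟩
  simpa [edist_dist] using this

theorem exists_bound (hx : PiecewiseLip a b x) : ∃ M, ∀ t ∈ Ico a b, ‖x t‖ ≤ M := by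
  refine piece_induction (motive := fun a => ∃ M, ∀ t ∈ Ico a b, ‖x t‖ ≤ M) ⟨0, by simp⟩ ?_ hx
  rintro a c K h1 _ _ hK ⟨M, hM⟩
  refine ⟨max M (‖x a‖ + K * (c - a)), fun t ht => ?_⟩
  rcases lt_or_ge t c with h | h
  · refine le_max_of_le_right ?_
    have h2 := hK.dist_le_mul t ⟨ht.1, h⟩ a ⟨le_rfl, h1⟩
    rw [dist_eq_norm, Real.dist_eq, abs_of_nonneg (by linarith [ht.1])] at h2
    have h3 : (K : ℝ) * (t - a) ≤ K * (c - a) := by gcongr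
    have h4 := norm_le_norm_add_norm_sub' (x t) (x a)
    linarith
  · exact le_max_of_le_left (hM t ⟨h, ht.2⟩)

theorem aestronglyMeasurable (hx : PiecewiseLip a b x) :
    AEStronglyMeasurable x (volume.restrict (Ico a b)) := by
  refine piece_induction
    (motive := fun a => AEStronglyMeasurable x (volume.restrict (Ico a b))) (by simp) ?_ hx
  intro a c K h1 h2 _ hK ih
  rw [← Ico_union_Ico_eq_Ico h1.le h2, aestronglyMeasurable_union_iff]
  exact ⟨hK.continuousOn.aestronglyMeasurable measurableSet_Ico, ih⟩

theorem continuousWithinAt_Ici (hx : PiecewiseLip a b x) :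
    ∀ t ∈ Ico a b, ContinuousWithinAt x (Ici t) t := by
  refine piece_induction (motive := fun a => ∀ t ∈ Ico a b, ContinuousWithinAt x (Ici t) t)
    (by simp) ?_ hx
  intro a c K h1 _ _ hK ih t ht
  rcases lt_or_ge t c with h | h
  · have h2 : ContinuousWithinAt x (Ico t c) t :=
      (hK.continuousOn t ⟨ht.1, h⟩).mono (Ico_subset_Ico_left ht.1)
    exact h2.mono_of_mem_nhdsWithin (Ico_mem_nhdsGE h)
  · exact ih t ⟨h, ht.2⟩

end PiecewiseLip

/-- `g` is locally Lipschitz on the convex set `[0, ϑ] × ℝⁿ`, hence Lipschitz on compact pieces. -/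
theorem CondG.exists_lipschitzOnWith {ϑ : ℝ} {g : ℝ → Rn n → Rn n} (hg : CondG ϑ g) (M : ℝ) :
    ∃ K : NNReal, LipschitzOnWith K (fun q : ℝ × Rn n => g q.1 q.2)
      (Icc 0 ϑ ×ˢ Metric.closedBall 0 M) := by
  have hconv : Convex ℝ (Icc 0 ϑ ×ˢ (univ : Set (Rn n))) := (convex_Icc _ _).prod convex_univ
  have h1 := hg.locallyLipschitzOn hconv
  exact (h1.mono (prod_mono_right (subset_univ _))).exists_lipschitzOnWith_of_compact
    (isCompact_Icc.prod (isCompact_closedBall _ _))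

/-! ### Increment bounds and derivative bounds -/

/-- A Lipschitz function whose derivative is a.e. bounded by `ρ` has increments bounded by the integral
of `ρ`. -/
theorem norm_sub_le_integral_of_ae_deriv {a b : ℝ} (hab : a ≤ b) {y : ℝ → Rn n} {ρ : ℝ → ℝ}
    {K : NNReal} (hK : LipschitzOnWith K y (Icc a b)) (hρ : IntervalIntegrable ρ volume a b)
    (hd : ∀ᵐ t : ℝ, t ∈ Icc a b → ∃ l, ‖l‖ ≤ ρ t ∧ HasDerivWithinAt y l (Icc a b) t) :
    ‖y b - y a‖ ≤ ∫ t in a..b, ρ t := by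
  set e := y b - y a with he
  rcases eq_or_ne e 0 with h0 | h0
  · rw [h0, norm_zero]
    refine intervalIntegral.integral_nonneg_of_ae_restrict hab ?_
    rw [EventuallyLE, ae_restrict_iff' measurableSet_Icc]
    filter_upwards [hd] with t ht hmem
    obtain ⟨l, hl, -⟩ := ht hmem
    exact (norm_nonneg l).trans hl
  -- Testing against the increment itself reduces the estimate to a scalar function.
  set f : ℝ → ℝ := fun t => inner ℝ e (y t) with hf
  have hfL : LipschitzOnWith (‖e‖₊ * K) f (Icc a b) :=
    by
    have h1 := (innerSL ℝ e).lipschitz.comp_lipschitzOnWith hK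
    have h2 : ‖innerSL ℝ e‖₊ = ‖e‖₊ := NNReal.eq (innerSL_apply_norm ℝ e)
    rw [h2] at h1
    exact h1
  have hac : AbsolutelyContinuousOnInterval f a b := by
    apply LipschitzOnWith.absolutelyContinuousOnInterval
    rwa [uIcc_of_le hab]
  have hint := hac.integral_deriv_eq_sub
  have hle : ∫ t in a..b, deriv f t ≤ ∫ t in a..b, ‖e‖ * ρ t := by
    refine intervalIntegral.integral_mono_ae_restrict hab hac.intervalIntegrable_deriv
      (hρ.const_mul _) ?_
    rw [EventuallyLE, ae_restrict_iff' measurableSet_Icc]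
    have ha : ∀ᵐ t : ℝ, t ≠ a := by simp [ae_iff]
    have hb : ∀ᵐ t : ℝ, t ≠ b := by simp [ae_iff]
    filter_upwards [hd, ha, hb] with t ht hta htb hmem
    obtain ⟨l, hl, hder⟩ := ht hmem
    have hder' : HasDerivAt y l t := hder.hasDerivAt
      (Icc_mem_nhds (lt_of_le_of_ne hmem.1 (Ne.symm hta)) (lt_of_le_of_ne hmem.2 htb))
    have hfd : HasDerivAt f (inner ℝ e l) t :=
      ((innerSL ℝ e).hasFDerivAt (x := y t)).comp_hasDerivAt t hder'
    rw [hfd.deriv]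
    exact (real_inner_le_norm _ _).trans (by gcongr)
  rw [hint, intervalIntegral.integral_const_mul] at hle
  have h2 : f b - f a = ‖e‖ * ‖e‖ := by
    simp only [hf]
    rw [← inner_sub_right, ← he, real_inner_self_eq_norm_mul_norm]
  rw [h2] at hle
  exact le_of_mul_le_mul_left hle (norm_pos_iff.2 h0)

theorem integral_le_mul_of_bound {ρ : ℝ → ℝ} {a b s t C : ℝ} (hρ : IntervalIntegrable ρ volume a b)
    (hC : ∀ u ∈ Ico a b, ρ u ≤ C) (has : a ≤ s) (hst : s ≤ t) (htb : t ≤ b) :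
    ∫ u in s..t, ρ u ≤ C * (t - s) := by
  have h1 : ∫ u in s..t, ρ u ≤ ∫ u in s..t, C := by
    refine intervalIntegral.integral_mono_on_of_le_Ioo hst
      (hρ.mono_set ?_) (by simp) ?_
    · rw [uIcc_of_le hst, uIcc_of_le (has.trans (hst.trans htb))]
      exact Icc_subset_Icc has htb
    · exact fun u hu => hC u ⟨has.trans hu.1.le, hu.2.trans_le htb⟩
  simpa [mul_comm] using h1

theorem lipschitzOnWith_of_norm_sub_le_integral {a b C : ℝ} {y : ℝ → Rn n} {ρ : ℝ → ℝ}
    (hρ : IntervalIntegrable ρ volume a b) (hC : ∀ u ∈ Ico a b, ρ u ≤ C)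
    (hy : ∀ s t, a ≤ s → s ≤ t → t ≤ b → ‖y t - y s‖ ≤ ∫ u in s..t, ρ u) :
    LipschitzOnWith C.toNNReal y (Icc a b) := by
  have key : ∀ s t, a ≤ s → s ≤ t → t ≤ b → ‖y t - y s‖ ≤ C.toNNReal * |t - s| := by
    intro s t has hst htb
    refine (hy s t has hst htb).trans ((integral_le_mul_of_bound hρ hC has hst htb).trans ?_)
    rw [abs_of_nonneg (sub_nonneg.2 hst)]
    exact mul_le_mul_of_nonneg_right (Real.le_coe_toNNReal C) (sub_nonneg.2 hst)
  refine LipschitzOnWith.of_dist_le_mul fun s hs t ht => ?_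
  rw [dist_eq_norm, Real.dist_eq]
  rcases le_total s t with h | h
  · rw [norm_sub_rev, abs_sub_comm]
    exact key s t hs.1 h ht.2
  · exact key t s ht.1 h hs.2

/-- Converse of `norm_sub_le_integral_of_ae_deriv`, by Lebesgue differentiation of the integral. -/
theorem ae_deriv_of_norm_sub_le_integral {a b : ℝ} {y : ℝ → Rn n} {ρ : ℝ → ℝ}
    {K : NNReal} (hK : LipschitzOnWith K y (Icc a b)) (hρ : IntervalIntegrable ρ volume a b)
    (hy : ∀ s t, a ≤ s → s ≤ t → t ≤ b → ‖y t - y s‖ ≤ ∫ u in s..t, ρ u) :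
    ∀ᵐ t : ℝ, t ∈ Icc a b → ∃ l, ‖l‖ ≤ ρ t ∧ HasDerivWithinAt y l (Icc a b) t := by
  have ha : ∀ᵐ t : ℝ, t ≠ a := by simp [ae_iff]
  have hb : ∀ᵐ t : ℝ, t ≠ b := by simp [ae_iff]
  filter_upwards [hK.ae_differentiableWithinAt_of_mem_real, hρ.ae_hasDerivAt_integral, ha, hb]
    with t h1 h2 hta htb hmem
  have hta' : a < t := lt_of_le_of_ne hmem.1 (Ne.symm hta)
  have htb' : t < b := lt_of_le_of_ne hmem.2 htb
  have hab : a ≤ b := hta'.le.trans htb'.le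
  have hu : t ∈ uIcc a b := by rwa [uIcc_of_le hab]
  have hder := (h1 hmem).hasDerivWithinAt
  refine ⟨_, ?_, hder⟩
  have hder' := hder.hasDerivAt (Icc_mem_nhds hta' htb')
  have hint := h2 hu t hu
  have hmono : 𝓝[>] t ≤ 𝓝[≠] t := nhdsWithin_mono t fun u hu => (mem_Ioi.1 hu).ne'
  have t1 := ((hasDerivAt_iff_tendsto_slope.1 hder').mono_left hmono).norm
  have t2 := (hasDerivAt_iff_tendsto_slope.1 hint).mono_left hmono
  refine le_of_tendsto_of_tendsto t1 t2 ?_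
  filter_upwards [Ioo_mem_nhdsGT htb'] with u hu
  rw [slope_def_module, slope_def_module, norm_smul, intervalIntegral.integral_same, sub_zero,
    smul_eq_mul, Real.norm_of_nonneg (inv_nonneg.2 (sub_nonneg.2 hu.1.le))]
  exact mul_le_mul_of_nonneg_left (hy t u hmem.1 hu.1.le hu.2.le)
    (inv_nonneg.2 (sub_nonneg.2 hu.1.le))

/-- The radius `cH (1 + ‖x(t)‖ + ‖x(t - h)‖) + η` of the velocity ball along `x`. -/
noncomputable def rate (h cH η : ℝ) (x : ℝ → Rn n) (t : ℝ) : ℝ := cH * (1 + ‖x t‖ + ‖x (t - h)‖) + η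

theorem rate_nonneg {h cH η : ℝ} (hcH : 0 ≤ cH) (hη : 0 ≤ η) (x : ℝ → Rn n) (t : ℝ) :
    0 ≤ rate h cH η x t := by
  unfold rate; positivity

namespace PiecewiseLip
variable {h τ ϑ : ℝ} {x : ℝ → Rn n}

theorem delay (hx : PiecewiseLip (τ - h) ϑ x) (hh : 0 ≤ h) (hτ : τ ≤ ϑ) :
    PiecewiseLip τ ϑ fun t => x (t - h) := by
  have h1 := hx.shift h
  rw [sub_add_cancel] at h1
  exact h1.restrict_left hτ (by linarith)

theorem exists_rate_bound (hx : PiecewiseLip (τ - h) ϑ x) (hh : 0 ≤ h) {cH : ℝ}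
    (hcH : 0 ≤ cH) (η : ℝ) : ∃ C, ∀ t ∈ Ico τ ϑ, rate h cH η x t ≤ C := by
  obtain ⟨M, hM⟩ := hx.exists_bound
  refine ⟨cH * (1 + M + M) + η, fun t ht => ?_⟩
  have h1 := hM t ⟨by linarith [ht.1], ht.2⟩
  have h2 := hM (t - h) ⟨by linarith [ht.1], by linarith [ht.2]⟩
  unfold rate
  gcongr

theorem intervalIntegrable_rate (hx : PiecewiseLip (τ - h) ϑ x) (hh : 0 ≤ h) (hτ : τ ≤ ϑ)
    {cH η : ℝ} (hcH : 0 ≤ cH) (hη : 0 ≤ η) : IntervalIntegrable (rate h cH η x) volume τ ϑ := by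
  rw [intervalIntegrable_iff_integrableOn_Ico_of_le hτ]
  obtain ⟨C, hC⟩ := hx.exists_rate_bound hh hcH η
  have m1 := (hx.restrict_right (by linarith) hτ).aestronglyMeasurable
  have m2 := (hx.delay hh hτ).aestronglyMeasurable
  refine Integrable.of_bound (C := C) ?_ ?_
  · exact ((((m1.norm.const_add 1).add m2.norm).const_mul cH).add_const η)
  · rw [ae_restrict_iff' measurableSet_Ico]
    refine Eventually.of_forall fun t ht => ?_
    rw [Real.norm_of_nonneg (rate_nonneg hcH hη x t)]
    exact hC t ht

end PiecewiseLip

/-- Integral description of `X^η`: the a.e. bound on the derivative of the Lipschitz function `y`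
is equivalent to a bound on its increments. In this form the condition passes to pointwise limits
and to concatenations. -/
theorem mem_X_iff {h ϑ cH η τ : ℝ} (hh : 0 ≤ h) (hcH : 0 ≤ cH) (hη : 0 ≤ η) (hτ : τ ≤ ϑ)
    {g : ℝ → Rn n → Rn n} {z : Rn n} {w : Hist h n} {x : ℝ → Rn n} :
    x ∈ X ϑ cH g η τ z w ↔ x ∈ Lam ϑ τ z w ∧ ∀ s t, τ ≤ s → s ≤ t → t ≤ ϑ →
      ‖neutral h g x t - neutral h g x s‖ ≤ ∫ u in s..t, rate h cH η x u := by
  constructor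
  · rintro ⟨hL, ⟨K, hK⟩, hd⟩
    refine ⟨hL, fun s t hs hst ht => ?_⟩
    have hsub : Icc s t ⊆ Icc τ ϑ := Icc_subset_Icc hs ht
    refine norm_sub_le_integral_of_ae_deriv hst (hK.mono hsub)
      ((hL.1.intervalIntegrable_rate hh hτ hcH hη).mono_set ?_) ?_
    · rwa [uIcc_of_le hst, uIcc_of_le hτ]
    · filter_upwards [hd] with u hu hmem
      obtain ⟨l, hl, hder⟩ := hu (hsub hmem)
      exact ⟨l, hl, hder.mono hsub⟩
  · rintro ⟨hL, hy⟩
    have hρ := hL.1.intervalIntegrable_rate hh hτ hcH hη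
    obtain ⟨C, hC⟩ := hL.1.exists_rate_bound hh hcH η
    have hK := lipschitzOnWith_of_norm_sub_le_integral hρ hC hy
    exact ⟨hL, ⟨_, hK⟩, ae_deriv_of_norm_sub_le_integral hK hρ hy⟩

/-! ### Integrals of `H` along trajectories -/

section Hamiltonian
variable {ϑ : ℝ} {H : ℝ → Rn n → Rn n → Rn n → ℝ}

theorem CondH1.exists_bound (hH : CondH1 ϑ H) (M : ℝ) (s : Rn n) :
    ∃ C, ∀ t ∈ Icc 0 ϑ, ∀ u v : Rn n, ‖u‖ ≤ M → ‖v‖ ≤ M → ‖H t u v s‖ ≤ C := by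
  have hK : IsCompact (Icc 0 ϑ ×ˢ (Metric.closedBall (0 : Rn n) M ×ˢ
      (Metric.closedBall (0 : Rn n) M ×ˢ ({s} : Set (Rn n))))) :=
    isCompact_Icc.prod ((isCompact_closedBall _ _).prod
      ((isCompact_closedBall _ _).prod isCompact_singleton))
  obtain ⟨C, hC⟩ := hK.exists_bound_of_continuousOn
    (hH.mono (prod_mono_right (subset_univ _)))
  refine ⟨C, fun t ht u v hu hv => hC (t, u, v, s) ⟨ht, ?_, ?_, rfl⟩⟩ <;> simpa

theorem CondH1.aestronglyMeasurable (hH : CondH1 ϑ H) {a b : ℝ} (ha : 0 ≤ a) (hb : b ≤ ϑ)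
    {u v : ℝ → Rn n} (hu : AEStronglyMeasurable u (volume.restrict (Ico a b)))
    (hv : AEStronglyMeasurable v (volume.restrict (Ico a b))) (s : Rn n) :
    AEStronglyMeasurable (fun t => H t (u t) (v t) s) (volume.restrict (Ico a b)) := by
  rcases le_or_gt b a with hab | hab
  · simp [Ico_eq_empty_of_le hab]
  have h0 : 0 ≤ ϑ := ha.trans (hab.le.trans hb)
  have hc : Continuous fun q : ℝ × Rn n × Rn n =>
      H (projIcc 0 ϑ h0 q.1) q.2.1 q.2.2 s := by
    refine ContinuousOn.comp_continuous (f := fun q : ℝ × Rn n × Rn n =>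
      (((projIcc 0 ϑ h0 q.1 : ℝ), q.2.1, q.2.2, s) : ℝ × Rn n × Rn n × Rn n)) hH ?_ ?_
    · exact (continuous_subtype_val.comp (continuous_projIcc.comp continuous_fst)).prodMk
        (continuous_snd.fst.prodMk (continuous_snd.snd.prodMk continuous_const))
    · exact fun q => ⟨(projIcc 0 ϑ h0 q.1).2, mem_univ _⟩
  have hm := hc.comp_aestronglyMeasurable
    ((measurable_id.aestronglyMeasurable (μ := volume.restrict (Ico a b))).prodMk (hu.prodMk hv))
  refine hm.congr ?_
  rw [EventuallyEq, ae_restrict_iff' measurableSet_Ico]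
  refine Eventually.of_forall fun t ht => ?_
  simp [projIcc_of_mem h0 (show t ∈ Icc 0 ϑ from ⟨ha.trans ht.1, ht.2.le.trans hb⟩)]

theorem CondH1.intervalIntegrable (hH : CondH1 ϑ H) {h τ : ℝ} (hh : 0 ≤ h) (h0 : 0 ≤ τ)
    (hτ : τ ≤ ϑ) {x : ℝ → Rn n} (hx : PiecewiseLip (τ - h) ϑ x) (s : Rn n) :
    IntervalIntegrable (fun t => H t (x t) (x (t - h)) s) volume τ ϑ := by
  rw [intervalIntegrable_iff_integrableOn_Ico_of_le hτ]
  obtain ⟨M, hM⟩ := hx.exists_bound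
  obtain ⟨C, hC⟩ := hH.exists_bound M s
  refine Integrable.of_bound (C := C) (hH.aestronglyMeasurable h0 le_rfl
    (hx.restrict_right (by linarith) hτ).aestronglyMeasurable
    (hx.delay hh hτ).aestronglyMeasurable s) ?_
  rw [ae_restrict_iff' measurableSet_Ico]
  exact Eventually.of_forall fun t ht => hC t ⟨h0.trans ht.1, ht.2.le⟩ _ _
    (hM t ⟨by linarith [ht.1], ht.2⟩) (hM (t - h) ⟨by linarith [ht.1], by linarith [ht.2]⟩)

end Hamiltonian

/-! ### Construction and concatenation of trajectories -/

/-- The method of steps for `x(t) = y(t) + g(t, x(t - h))`, `t ≥ τ`, with the history `x₀`: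
`m` is the number of delays for which the equation has been unrolled. -/
noncomputable def stepIter (h τ : ℝ) (g : ℝ → Rn n → Rn n) (x₀ y : ℝ → Rn n) : ℕ → ℝ → Rn n
  | 0 => x₀
  | m + 1 => fun t =>
      open Classical in if t < τ then x₀ t else y t + g t (stepIter h τ g x₀ y m (t - h))

theorem exists_delay_solution {h : ℝ} (hh : 0 < h) (τ : ℝ) (g : ℝ → Rn n → Rn n)
    (x₀ y : ℝ → Rn n) :
    ∃ x : ℝ → Rn n, (∀ t < τ, x t = x₀ t) ∧ ∀ t, τ ≤ t → x t = y t + g t (x (t - h)) := by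
  refine ⟨fun t => stepIter h τ g x₀ y (⌊(t - τ) / h⌋₊ + 1) t, fun t ht => ?_, fun t ht => ?_⟩
  · simp [stepIter, ht]
  · have key : stepIter h τ g x₀ y ⌊(t - τ) / h⌋₊ (t - h) =
        stepIter h τ g x₀ y (⌊(t - h - τ) / h⌋₊ + 1) (t - h) := by
      have he : (t - h - τ) / h = (t - τ) / h - 1 := by field_simp; ring
      rcases lt_or_ge (t - h) τ with hlt | hge
      · have h1 : ⌊(t - τ) / h⌋₊ = 0 := by
          rw [Nat.floor_eq_zero, div_lt_one hh]; linarith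
        simp [h1, stepIter, hlt]
      · have h1 : 1 ≤ (t - τ) / h := by rw [one_le_div hh]; linarith
        have h2 : 1 ≤ ⌊(t - τ) / h⌋₊ := (Nat.one_le_floor_iff _).2 h1
        rw [he, Nat.floor_sub_one, Nat.sub_add_cancel h2]
    beta_reduce
    rw [← key]
    simp [stepIter, not_lt.2 ht]

theorem ext_apply {h : ℝ} (w : Hist h n) (ξ : Ico (-h) (0 : ℝ)) : ext w ξ = w ξ := by
  simp [ext]

theorem ext_seg {h : ℝ} (x : ℝ → Rn n) (t : ℝ) {ξ : ℝ} (hξ : ξ ∈ Ico (-h) (0 : ℝ)) :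
    ext (seg h x t) ξ = x (t + ξ) := by
  simp only [ext, hξ, dif_pos, seg]

theorem ext_sub {h : ℝ} (w w' : Hist h n) (ξ : ℝ) : ext (w - w') ξ = ext w ξ - ext w' ξ := by
  unfold ext; split_ifs <;> simp

section Trajectories
variable {h ϑ cH η τ : ℝ} {g : ℝ → Rn n → Rn n} {z : Rn n} {w : Hist h n}

theorem Lam_apply_of_lt {x : ℝ → Rn n} (hx : x ∈ Lam ϑ τ z w) {t : ℝ} (h1 : τ - h ≤ t)
    (h2 : t < τ) : x t = ext w (t - τ) := by
  have hm : t - τ ∈ Ico (-h) (0 : ℝ) := ⟨by linarith, by linarith⟩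
  rw [← hx.2.2, ext_seg x τ hm]
  congr 1; ring

theorem seg_mem_PLip {x : ℝ → Rn n} (hx : x ∈ Lam ϑ τ z w) (hh : 0 ≤ h) {t : ℝ} (h1 : τ ≤ t)
    (h2 : t ≤ ϑ) : seg h x t ∈ PLip := by
  have h3 : PiecewiseLip (t - h) t x :=
    (hx.1.restrict_left (by linarith) h2).restrict_right (by linarith) (by linarith)
  have h4 := h3.shift (-t)
  rw [show t - h + -t = -h by ring, add_neg_cancel] at h4
  refine h4.congr fun ξ hξ => ?_
  simp only [ext_seg x t hξ, sub_neg_eq_add, add_comm]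

/-- A function obeying the delay equation with Lipschitz `y` inherits piecewise Lipschitz
continuity from its history, one delay interval after another. -/
theorem PiecewiseLip.of_delay_equation (hh : 0 < h) (h0 : 0 ≤ τ) (hτ : τ ≤ ϑ) (hg : CondG ϑ g)
    {x y : ℝ → Rn n} {K : NNReal} (hy : LipschitzOnWith K y (Icc τ ϑ))
    (hx : PiecewiseLip (τ - h) τ x) (heq : ∀ t ∈ Icc τ ϑ, x t = y t + g t (x (t - h))) :
    PiecewiseLip (τ - h) ϑ x := by
  have key : ∀ m : ℕ, PiecewiseLip (τ - h) (min (τ + m * h) ϑ) x := by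
    intro m
    induction m with
    | zero => simpa [hτ] using hx
    | succ m ih =>
      have hmh : 0 ≤ (m : ℝ) * h := by positivity
      push_cast
      set b := min (τ + m * h) ϑ with hb
      set b' := min (τ + (m + 1) * h) ϑ with hb'
      have hτb : τ ≤ b := le_min (by linarith) hτ
      have hbb' : b ≤ b' := min_le_min_right _ (by linarith)
      have hb'b : b' ≤ b + h := by
        rw [hb, hb', ← min_add_add_right]
        exact min_le_min (by linarith) (by linarith)
      have hb'ϑ : b' ≤ ϑ := min_le_right _ _
      refine ih.trans ?_
      have hsh := ih.shift h
      rw [sub_add_cancel] at hsh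
      have hd : PiecewiseLip b b' fun t => x (t - h) :=
        (hsh.restrict_left (hτb.trans hbb') hb'b).restrict_right hτb hbb'
      obtain ⟨M, hM⟩ := hd.exists_bound
      obtain ⟨Kg, hKg⟩ := hg.exists_lipschitzOnWith M
      refine hd.map fun c d K₁ hc hd' hK₁ => ?_
      have hgl : LipschitzOnWith (Kg * max 1 K₁) (fun t => g t (x (t - h))) (Ico c d) := by
        refine hKg.comp (f := fun t => (t, x (t - h))) ?_ ?_
        · exact LipschitzOnWith.prodMk (LipschitzWith.id.lipschitzOnWith) hK₁
        · intro t ht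
          refine ⟨⟨by linarith [ht.1], by linarith [ht.2]⟩, ?_⟩
          simpa using hM t ⟨hc.trans ht.1, ht.2.trans_le hd'⟩
      have hsub : Ico c d ⊆ Icc τ ϑ := fun t ht => ⟨by linarith [ht.1], by linarith [ht.2]⟩
      refine ⟨K + Kg * max 1 K₁, fun s hs t ht => ?_⟩
      rw [heq s (hsub hs), heq t (hsub ht)]
      exact ((hy.mono hsub).add hgl) hs ht
  obtain ⟨m, hm⟩ := exists_nat_ge ((ϑ - τ) / h)
  have h1 : ϑ ≤ τ + m * h := by
    rw [div_le_iff₀ hh] at hm; linarith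
  simpa [h1] using key m

/-- Every Lipschitz `y` with the right initial value comes from a function in `Λ(τ, z, w)`. -/
theorem exists_mem_Lam_neutral_eq (hh : 0 < h) (h0 : 0 ≤ τ) (hτ : τ ≤ ϑ) (hg : CondG ϑ g)
    (hw : w ∈ PLip) {y : ℝ → Rn n} {K : NNReal} (hy : LipschitzOnWith K y (Icc τ ϑ))
    (hyτ : y τ = z - g τ (ext w (-h))) :
    ∃ x ∈ Lam ϑ τ z w, ∀ t, τ ≤ t → neutral h g x t = y t := by
  obtain ⟨x, hx1, hx2⟩ := exists_delay_solution hh τ g (fun t => ext w (t - τ)) y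
  refine ⟨x, ⟨?_, ?_, ?_⟩, fun t ht => ?_⟩
  · refine PiecewiseLip.of_delay_equation hh h0 hτ hg hy ?_ fun t ht => hx2 t ht.1
    have h1 := hw.shift τ
    rw [zero_add, neg_add_eq_sub] at h1
    exact h1.congr fun t ht => (hx1 t ht.2).symm
  · rw [hx2 τ le_rfl, hx1 (τ - h) (by linarith), hyτ, show τ - h - τ = -h by ring,
      sub_add_cancel]
  · funext ξ
    have := ξ.2.2
    rw [seg, hx1 _ (by linarith), add_sub_cancel_left, ext_apply]
  · rw [neutral, hx2 t ht, add_sub_cancel_right]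

/-- Trajectories can be concatenated at a time `τ₁`: the second one starts from the state of the first,
history included, so `y` stays continuous there, and `ω` is additive in time. -/
theorem exists_concat {H : ℝ → Rn n → Rn n → Rn n → ℝ} (hH : CondH1 ϑ H) (hh : 0 < h)
    (hcH : 0 ≤ cH) (hη : 0 ≤ η) {τ₁ : ℝ} (h0 : 0 ≤ τ) (hτ : τ ≤ τ₁) (hτ₁ : τ₁ ≤ ϑ)
    {x₁ x₂ : ℝ → Rn n} (hx₁ : x₁ ∈ X ϑ cH g η τ z w)
    (hx₂ : x₂ ∈ X ϑ cH g η τ₁ (x₁ τ₁) (seg h x₁ τ₁)) :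
    ∃ x ∈ X ϑ cH g η τ z w, ∀ t ∈ Icc τ₁ ϑ, x t = x₂ t ∧ seg h x t = seg h x₂ t ∧
      ∀ s, omega h g H τ t x s = omega h g H τ τ₁ x₁ s + omega h g H τ₁ t x₂ s := by
  classical
  rw [mem_X_iff hh.le hcH hη (hτ.trans hτ₁)] at hx₁
  rw [mem_X_iff hh.le hcH hη hτ₁] at hx₂
  obtain ⟨hL₁, hy₁⟩ := hx₁
  obtain ⟨hL₂, hy₂⟩ := hx₂
  set x : ℝ → Rn n := fun t => if t < τ₁ then x₁ t else x₂ t with hx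
  have e1 : ∀ t, t ≤ τ₁ → x t = x₁ t := by
    intro t ht
    rcases ht.lt_or_eq with h1 | rfl
    · simp [hx, h1]
    · simp [hx, hL₂.2.1]
  have e2 : ∀ t, τ₁ - h ≤ t → x t = x₂ t := by
    intro t ht
    by_cases h1 : t < τ₁
    · rw [Lam_apply_of_lt hL₂ ht h1, ext_seg x₁ τ₁ ⟨by linarith, by linarith⟩, e1 t h1.le]
      congr 1; ring
    · simp [hx, h1]
  have n1 : ∀ t, t ≤ τ₁ → neutral h g x t = neutral h g x₁ t := by
    intro t ht
    rw [neutral, neutral, e1 t ht, e1 (t - h) (by linarith)]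
  have n2 : ∀ t, τ₁ ≤ t → neutral h g x t = neutral h g x₂ t := by
    intro t ht
    rw [neutral, neutral, e2 t (by linarith), e2 (t - h) (by linarith)]
  have r1 : ∀ t, t ≤ τ₁ → rate h cH η x t = rate h cH η x₁ t := by
    intro t ht
    rw [rate, rate, e1 t ht, e1 (t - h) (by linarith)]
  have r2 : ∀ t, τ₁ ≤ t → rate h cH η x t = rate h cH η x₂ t := by
    intro t ht
    rw [rate, rate, e2 t (by linarith), e2 (t - h) (by linarith)]
  have hL : x ∈ Lam ϑ τ z w := by
    refine ⟨?_, ?_, ?_⟩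
    · refine PiecewiseLip.trans (b := τ₁) ?_ ?_
      · exact (hL₁.1.restrict_left (by linarith) hτ₁).congr fun t ht => (e1 t ht.2.le).symm
      · exact (hL₂.1.restrict_right (by linarith) hτ₁).congr
          fun t ht => (e2 t (by linarith [ht.1])).symm
    · rw [e1 τ hτ, hL₁.2.1]
    · rw [← hL₁.2.2]
      funext ξ
      exact e1 _ (by linarith [ξ.2.2])
  have b1 : ∀ s t, τ ≤ s → s ≤ t → t ≤ τ₁ →
      ‖neutral h g x t - neutral h g x s‖ ≤ ∫ u in s..t, rate h cH η x u := by
    intro s t hs hst ht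
    rw [n1 t ht, n1 s (hst.trans ht)]
    refine (hy₁ s t hs hst (ht.trans hτ₁)).trans_eq ?_
    refine intervalIntegral.integral_congr fun u hu => ?_
    rw [uIcc_of_le hst] at hu
    exact (r1 u (hu.2.trans ht)).symm
  have b2 : ∀ s t, τ₁ ≤ s → s ≤ t → t ≤ ϑ →
      ‖neutral h g x t - neutral h g x s‖ ≤ ∫ u in s..t, rate h cH η x u := by
    intro s t hs hst ht
    rw [n2 t (hs.trans hst), n2 s hs]
    refine (hy₂ s t hs hst ht).trans_eq ?_
    refine intervalIntegral.integral_congr fun u hu => ?_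
    rw [uIcc_of_le hst] at hu
    exact (r2 u (hs.trans hu.1)).symm
  refine ⟨x, (mem_X_iff hh.le hcH hη (hτ.trans hτ₁)).2 ⟨hL, fun s t hs hst ht => ?_⟩,
    fun t ht => ⟨e2 t (by linarith [ht.1]), ?_, fun s => ?_⟩⟩
  · rcases le_total t τ₁ with h1 | h1
    · exact b1 s t hs hst h1
    rcases le_total τ₁ s with h2 | h2
    · exact b2 s t h2 hst ht
    have hi := hL.1.intervalIntegrable_rate hh.le (hτ.trans hτ₁) hcH hη
    have hi' : ∀ a b, τ ≤ a → a ≤ b → b ≤ ϑ →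
        IntervalIntegrable (rate h cH η x) volume a b := by
      intro a b ha hab hb
      refine hi.mono_set ?_
      rw [uIcc_of_le hab, uIcc_of_le (hτ.trans hτ₁)]
      exact Icc_subset_Icc ha hb
    rw [← intervalIntegral.integral_add_adjacent_intervals (hi' s τ₁ hs h2 hτ₁)
      (hi' τ₁ t hτ h1 ht)]
    have := norm_add_le (neutral h g x t - neutral h g x τ₁)
      (neutral h g x τ₁ - neutral h g x s)
    rw [sub_add_sub_cancel] at this
    linarith [b1 s τ₁ hs h2 le_rfl, b2 τ₁ t le_rfl h1 ht]
  · funext ξ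
    exact e2 _ (by linarith [ξ.2.1, ht.1])
  · have hi := hH.intervalIntegrable hh.le h0 (hτ.trans hτ₁) hL.1 s
    have hi' : ∀ a b, τ ≤ a → a ≤ b → b ≤ ϑ →
        IntervalIntegrable (fun t => H t (x t) (x (t - h)) s) volume a b := by
      intro a b ha hab hb
      refine hi.mono_set ?_
      rw [uIcc_of_le hab, uIcc_of_le (hτ.trans hτ₁)]
      exact Icc_subset_Icc ha hb
    have i1 : ∫ u in τ..τ₁, H u (x u) (x (u - h)) s =
        ∫ u in τ..τ₁, H u (x₁ u) (x₁ (u - h)) s := by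
      refine intervalIntegral.integral_congr fun u hu => ?_
      rw [uIcc_of_le hτ] at hu
      simp only [e1 u hu.2, e1 (u - h) (by linarith [hu.2])]
    have i2 : ∫ u in τ₁..t, H u (x u) (x (u - h)) s =
        ∫ u in τ₁..t, H u (x₂ u) (x₂ (u - h)) s := by
      refine intervalIntegral.integral_congr fun u hu => ?_
      rw [uIcc_of_le ht.1] at hu
      simp only [e2 u (by linarith [hu.1]), e2 (u - h) (by linarith [hu.1])]
    rw [omega, omega, omega, ← intervalIntegral.integral_add_adjacent_intervals
      (hi' τ τ₁ le_rfl hτ hτ₁) (hi' τ₁ t hτ ht.1 ht.2), i1, i2, ← n1 τ hτ, ← n1 τ₁ le_rfl,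
      ← n2 t ht.1, ← n2 τ₁ le_rfl]
    simp only [inner_sub_left]
    ring

end Trajectories

/-! ### Smooth approximation of histories -/

/-- The forward average of `f` over `[ξ, ξ + δ]`. -/
noncomputable def forwardAvg (δ : ℝ) (f : ℝ → Rn n) (ξ : ℝ) : Rn n := δ⁻¹ • ∫ u in ξ..ξ + δ, f u

section forwardAvg
variable {f : ℝ → Rn n} {δ : ℝ}

theorem intervalIntegrable_of_bounded {α : ℝ} (hf : AEStronglyMeasurable f volume)
    (hα : ∀ u, ‖f u‖ ≤ α) (a b : ℝ) : IntervalIntegrable f volume a b := by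
  rw [intervalIntegrable_iff]
  have : IsFiniteMeasure (volume.restrict (uIoc a b)) := ⟨by simp [uIoc]⟩
  exact Integrable.of_bound hf.restrict α (Eventually.of_forall hα)

theorem norm_forwardAvg_sub_le (hf : ∀ a b, IntervalIntegrable f volume a b) (hδ : 0 < δ)
    {ξ ε : ℝ} {c : Rn n} (hc : ∀ u ∈ Icc ξ (ξ + δ), ‖f u - c‖ ≤ ε) :
    ‖forwardAvg δ f ξ - c‖ ≤ ε := by
  have h1 : forwardAvg δ f ξ - c = δ⁻¹ • ∫ u in ξ..ξ + δ, (f u - c) := by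
    rw [intervalIntegral.integral_sub (hf _ _) (by simp), intervalIntegral.integral_const,
      add_sub_cancel_left, smul_sub, smul_smul, inv_mul_cancel₀ hδ.ne', one_smul, forwardAvg]
  have h2 : ‖∫ u in ξ..ξ + δ, (f u - c)‖ ≤ ε * |ξ + δ - ξ| := by
    refine intervalIntegral.norm_integral_le_of_norm_le_const fun u hu => hc u ?_
    rw [uIoc_of_le (by linarith)] at hu
    exact Ioc_subset_Icc_self hu
  rw [add_sub_cancel_left, abs_of_pos hδ] at h2
  rw [h1, norm_smul, Real.norm_of_nonneg (inv_nonneg.2 hδ.le)]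
  calc δ⁻¹ * ‖∫ u in ξ..ξ + δ, (f u - c)‖ ≤ δ⁻¹ * (ε * δ) := by gcongr
    _ = ε := by field_simp

theorem forwardAvg_eq (hf : ∀ a b, IntervalIntegrable f volume a b) (δ : ℝ) :
    forwardAvg δ f = fun ξ => δ⁻¹ • ((∫ u in (0 : ℝ)..ξ + δ, f u) - ∫ u in (0 : ℝ)..ξ, f u) := by
  funext ξ
  rw [forwardAvg, intervalIntegral.integral_interval_sub_left (hf _ _) (hf _ _)]

theorem continuous_forwardAvg (hf : ∀ a b, IntervalIntegrable f volume a b) (δ : ℝ) :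
    Continuous (forwardAvg δ f) := by
  have h1 := intervalIntegral.continuous_primitive hf 0
  rw [forwardAvg_eq hf]
  exact ((h1.comp (continuous_add_const δ)).sub h1).const_smul δ⁻¹

theorem contDiff_forwardAvg (hf : Continuous f) (δ : ℝ) : ContDiff ℝ 1 (forwardAvg δ f) := by
  have h1 : ContDiff ℝ 1 fun ξ => ∫ u in (0 : ℝ)..ξ, f u := by
    rw [contDiff_one_iff_deriv]
    refine ⟨fun ξ => (hf.integral_hasStrictDerivAt 0 ξ).hasDerivAt.differentiableAt, ?_⟩
    have : deriv (fun ξ => ∫ u in (0 : ℝ)..ξ, f u) = f := by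
      funext ξ
      exact hf.deriv_integral f 0 ξ
    rwa [this]
  rw [forwardAvg_eq fun a b => hf.intervalIntegrable a b]
  exact ((h1.comp (contDiff_id.add contDiff_const)).sub h1).const_smul _

end forwardAvg

theorem mem_PLip_of_mem_Lip {h : ℝ} (hh : 0 ≤ h) {w : Hist h n} (hw : w ∈ Lip) : w ∈ PLip := by
  obtain ⟨K, hK⟩ := hw
  refine PiecewiseLip.of_lipschitzOnWith (K := K) (by linarith) ?_
  intro a ha b hb
  have := hK ⟨a, ha⟩ ⟨b, hb⟩
  simpa only [ext, ha, hb, dif_pos, Subtype.edist_mk_mk] using this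

/-- The restriction to `[-h, 0)` of a `C¹` function on the line belongs to `C¹`. -/
theorem mem_C1_of_contDiff {h : ℝ} {V : ℝ → Rn n} (hV : ContDiff ℝ 1 V) :
    (fun ξ : Ico (-h) (0 : ℝ) => V ξ) ∈ (C1 : Set (Hist h n)) := by
  constructor
  · obtain ⟨K, hK⟩ := hV.locallyLipschitz.locallyLipschitzOn.exists_lipschitzOnWith_of_compact
      (isCompact_Icc (a := -h) (b := 0))
    exact ⟨K, (hK.mono Ico_subset_Icc_self).to_restrict⟩
  · exact hV.contDiffOn.congr fun ξ hξ => ext_apply _ ⟨ξ, hξ⟩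

theorem endLim_of_continuous {h : ℝ} (hh : 0 < h) {V : ℝ → Rn n} (hV : Continuous V) :
    endLim (fun ξ : Ico (-h) (0 : ℝ) => V ξ) = V 0 := by
  refine leftLim_eq_of_tendsto ?_
  refine ((hV.tendsto 0).mono_left nhdsWithin_le_nhds).congr' ?_
  filter_upwards [Ico_mem_nhdsLT (neg_neg_of_pos hh)] with ξ hξ
  exact (ext_apply (fun ξ : Ico (-h) (0 : ℝ) => V ξ) ⟨ξ, hξ⟩).symm

/-- Any pair `(z, w)` with `w ∈ PLip` is a bounded pointwise limit of `C¹` histories ending at `z`.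
Extend `w` by `z` to the right of `0` and average forward twice: the first average is
continuous, the second `C¹`, and the limits are right because `w` is right-continuous. -/
theorem exists_C1_approx {h : ℝ} (hh : 0 < h) {α : ℝ} {z : Rn n} {w : Hist h n}
    (hzw : (z, w) ∈ P α) :
    ∃ v : ℕ → Hist h n, (∀ k, v k ∈ C1 ∧ endLim (v k) = z ∧ (z, v k) ∈ P α) ∧
      ∀ ξ ∈ Ico (-h) (0 : ℝ), Tendsto (fun k => ext (v k) ξ) atTop (𝓝 (ext w ξ)) := by
  obtain ⟨hw, hzα, hwα⟩ := hzw
  simp only at hw hzα hwα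
  have hα : 0 ≤ α := (norm_nonneg z).trans hzα
  set f : ℝ → Rn n := fun u => if u < 0 then ext w u else z with hf
  have f_neg : ∀ u < 0, f u = ext w u := fun u hu => by simp [hf, hu]
  have f_nonneg : ∀ u, 0 ≤ u → f u = z := fun u hu => by simp [hf, not_lt.2 hu]
  have hfα : ∀ u, ‖f u‖ ≤ α := by
    intro u
    rcases lt_or_ge u 0 with h1 | h1
    · rw [f_neg u h1]
      unfold ext
      split_ifs with h2
      · exact hwα _
      · simpa
    · rwa [f_nonneg u h1]
  have hfm : AEStronglyMeasurable f volume := by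
    have h1 : f = (Ico (-h) 0).indicator (ext w) + (Ici 0).indicator (fun _ => z) := by
      funext u
      rcases lt_or_ge u 0 with h2 | h2
      · by_cases h3 : -h ≤ u <;>
          simp [f_neg u h2, h2, not_le.2 h2, h3, indicator, ext]
      · simp [f_nonneg u h2, h2, not_lt.2 h2, indicator]
    rw [h1]
    refine AEStronglyMeasurable.add ?_ ?_
    · exact (aestronglyMeasurable_indicator_iff measurableSet_Ico).2
        (PiecewiseLip.aestronglyMeasurable hw)
    · exact aestronglyMeasurable_const.indicator measurableSet_Ici
  have hfi := intervalIntegrable_of_bounded hfm hfα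
  have hgc : ∀ δ, Continuous (forwardAvg δ f) := continuous_forwardAvg hfi
  have hgi : ∀ δ a b, IntervalIntegrable (forwardAvg δ f) volume a b :=
    fun δ a b => (hgc δ).intervalIntegrable a b
  set V : ℝ → ℝ → Rn n := fun δ => forwardAvg δ (forwardAvg δ f) with hV
  have near : ∀ δ > 0, ∀ (ξ ε : ℝ) (c : Rn n), (∀ u ∈ Icc ξ (ξ + 2 * δ), ‖f u - c‖ ≤ ε) →
      ‖V δ ξ - c‖ ≤ ε := by
    intro δ hδ ξ ε c hc
    refine norm_forwardAvg_sub_le (hgi δ) hδ fun u hu => ?_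
    refine norm_forwardAvg_sub_le hfi hδ fun u' hu' => hc u' ?_
    exact ⟨hu.1.trans hu'.1, by linarith [hu.2, hu'.2]⟩
  have hVC : ∀ δ, ContDiff ℝ 1 (V δ) := fun δ => contDiff_forwardAvg (hgc δ) δ
  have hV0 : ∀ δ > 0, V δ 0 = z := by
    intro δ hδ
    have := near δ hδ 0 0 z fun u hu => by simp [f_nonneg u hu.1]
    exact sub_eq_zero.1 (norm_le_zero_iff.1 this)
  have hVα : ∀ δ > 0, ∀ ξ, ‖V δ ξ‖ ≤ α := by
    intro δ hδ ξ
    simpa using near δ hδ ξ α 0 fun u _ => by simpa using hfα u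
  have hpos : ∀ k : ℕ, (0 : ℝ) < 1 / ((k : ℝ) + 1) := fun k => Nat.one_div_pos_of_nat
  refine ⟨fun k ξ => V (1 / ((k : ℝ) + 1)) ξ, fun k => ⟨mem_C1_of_contDiff (hVC _), ?_, ?_⟩, ?_⟩
  · rw [endLim_of_continuous hh (hVC _).continuous, hV0 _ (hpos k)]
  · exact ⟨mem_PLip_of_mem_Lip hh.le (mem_C1_of_contDiff (hVC _)).1, hzα,
      fun ξ => hVα _ (hpos k) _⟩
  · intro ξ hξ
    have hcont : ContinuousWithinAt f (Ici ξ) ξ := by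
      have h1 : ContinuousWithinAt (ext w) (Ici ξ) ξ :=
        PiecewiseLip.continuousWithinAt_Ici hw ξ hξ
      refine h1.congr_of_eventuallyEq ?_ (f_neg ξ hξ.2)
      filter_upwards [mem_nhdsWithin_of_mem_nhds (Iio_mem_nhds hξ.2)] with u hu using f_neg u hu
    rw [Metric.tendsto_atTop]
    intro ε hε
    obtain ⟨r, hr, hrε⟩ := Metric.continuousWithinAt_iff.1 hcont (ε / 2) (half_pos hε)
    obtain ⟨m, hm⟩ := exists_nat_one_div_lt (show 0 < r / 2 by linarith)
    refine ⟨m, fun k hk => ?_⟩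
    have hkm : 1 / ((k : ℝ) + 1) ≤ 1 / ((m : ℝ) + 1) := Nat.one_div_le_one_div hk
    have he : ext (fun ξ : Ico (-h) (0 : ℝ) => V (1 / ((k : ℝ) + 1)) ξ) ξ =
      V (1 / ((k : ℝ) + 1)) ξ := ext_apply _ ⟨ξ, hξ⟩
    rw [he, dist_eq_norm, ← f_neg ξ hξ.2]
    refine lt_of_le_of_lt (near _ (hpos k) ξ (ε / 2) _ fun u hu => ?_) (half_lt_self hε)
    rw [← dist_eq_norm]
    refine (hrε hu.1 ?_).le
    rw [Real.dist_eq, abs_of_nonneg (by linarith [hu.1])]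
    linarith [hu.2]

/-! ### Continuity under bounded pointwise convergence -/

theorem exists_mem_P {h : ℝ} (z : Rn n) {w : Hist h n} (hw : w ∈ PLip) :
    ∃ α > 0, (z, w) ∈ P α := by
  obtain ⟨M, hM⟩ := PiecewiseLip.exists_bound hw
  refine ⟨max 1 (max ‖z‖ M), lt_of_lt_of_le one_pos (le_max_left _ _), hw,
    le_max_of_le_right (le_max_left _ _), fun ξ => ?_⟩
  have h1 := hM ξ ξ.2
  rw [ext_apply] at h1
  exact le_max_of_le_right (le_max_of_le_right h1)

section Convergence
variable {h α : ℝ} {z : Rn n} {w : Hist h n} {zs : ℕ → Rn n} {ws : ℕ → Hist h n}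

theorem tendsto_norm1_sub (hws : ∀ k, (zs k, ws k) ∈ P α) (hw : (z, w) ∈ P α)
    (hlim : ∀ ξ ∈ Ico (-h) (0 : ℝ), Tendsto (fun k => ext (ws k) ξ) atTop (𝓝 (ext w ξ))) :
    Tendsto (fun k => norm1 (ws k - w)) atTop (𝓝 0) := by
  have h0 : ∫ _ξ in Ico (-h) (0 : ℝ), (0 : ℝ) = 0 := by simp
  suffices key : Tendsto (fun k => norm1 (ws k - w)) atTop
      (𝓝 (∫ _ξ in Ico (-h) (0 : ℝ), (0 : ℝ))) by rwa [h0] at key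
  unfold norm1
  refine tendsto_integral_of_dominated_convergence (fun _ => α + α) (fun k => ?_) (by simp)
    (fun k => ?_) ?_
  · simp only [ext_sub]
    exact ((PiecewiseLip.aestronglyMeasurable (hws k).1).sub
      (PiecewiseLip.aestronglyMeasurable hw.1)).norm
  · rw [ae_restrict_iff' measurableSet_Ico]
    refine Eventually.of_forall fun ξ hξ => ?_
    rw [norm_norm, ext_sub]
    refine (norm_sub_le _ _).trans (add_le_add ?_ ?_)
    · rw [show ext (ws k) ξ = ws k ⟨ξ, hξ⟩ from ext_apply _ ⟨ξ, hξ⟩]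
      exact (hws k).2.2 _
    · rw [show ext w ξ = w ⟨ξ, hξ⟩ from ext_apply _ ⟨ξ, hξ⟩]
      exact hw.2.2 _
  · rw [ae_restrict_iff' measurableSet_Ico]
    refine Eventually.of_forall fun ξ hξ => ?_
    simp only [ext_sub]
    exact tendsto_iff_norm_sub_tendsto_zero.1 (hlim ξ hξ)

/-- `φ(T, ·)` is sequentially continuous under bounded pointwise convergence of histories: the terms
of `υ` are an integral and values at points of `[-h, 0)`. -/
theorem CondPhi2.tendsto {N : ℕ} {ϑ : ℝ} {φ : ℝ → Rn n → Hist h n → ℝ} (hφ : CondPhi2 N ϑ φ)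
    (hh : 0 < h) (hN : ϑ = N * h) {T : ℝ} (hT : T ∈ Icc 0 ϑ) (hα : 0 < α)
    (hws : ∀ k, (zs k, ws k) ∈ P α) (hw : (z, w) ∈ P α) (hz : Tendsto zs atTop (𝓝 z))
    (hlim : ∀ ξ ∈ Ico (-h) (0 : ℝ), Tendsto (fun k => ext (ws k) ξ) atTop (𝓝 (ext w ξ))) :
    Tendsto (fun k => φ T (zs k) (ws k)) atTop (𝓝 (φ T z w)) := by
  obtain ⟨lam, -, hlam⟩ := hφ α hα
  -- The index with `T ∈ (ih, (i+1)h]`; it is `-1` at `T = 0`.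
  set i : ℤ := ⌈T / h⌉ - 1 with hi
  have h1 : T / h ≤ ⌈T / h⌉ := Int.le_ceil _
  have h2 : (⌈T / h⌉ : ℝ) < T / h + 1 := Int.ceil_lt_add_one _
  have hi' : (i : ℝ) = ⌈T / h⌉ - 1 := by simp [hi]
  have hmem : T ∈ Ioc (i * h) ((i + 1) * h) := by
    constructor
    · rw [← lt_div_iff₀ hh]; linarith
    · rw [← div_le_iff₀ hh]; linarith
  have hlow : -1 ≤ i := by
    have : 0 ≤ ⌈T / h⌉ := Int.ceil_nonneg (div_nonneg hT.1 hh.le)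
    omega
  have hup : i ≤ (N : ℤ) - 1 := by
    have : ⌈T / h⌉ ≤ (N : ℤ) := by
      rw [Int.ceil_le, div_le_iff₀ hh]
      simpa [← hN] using hT.2
    omega
  have hυ : Tendsto (fun k => lam * upsilon i T (zs k - z) (ws k - w)) atTop (𝓝 0) := by
    have e : lam * (0 + 0 + 0 + 0) = 0 := by ring
    suffices key : Tendsto (fun k => lam * upsilon i T (zs k - z) (ws k - w)) atTop
        (𝓝 (lam * (0 + 0 + 0 + 0))) by rwa [e] at key
    unfold upsilon
    simp only [ext_sub]
    refine Tendsto.const_mul _ (((Tendsto.add ?_ ?_).add ?_).add ?_)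
    · exact tendsto_iff_norm_sub_tendsto_zero.1 hz
    · exact tendsto_norm1_sub hws hw hlim
    · exact tendsto_iff_norm_sub_tendsto_zero.1 (hlim _ ⟨le_rfl, by linarith⟩)
    · refine tendsto_iff_norm_sub_tendsto_zero.1 (hlim _ ⟨?_, ?_⟩)
      · linarith [hmem.2]
      · linarith [hmem.1]
  rw [tendsto_iff_dist_tendsto_zero]
  refine squeeze_zero (fun _ => dist_nonneg) (fun k => ?_) hυ
  rw [Real.dist_eq]
  exact hlam T hT i hlow hup hmem _ _ _ _ (hws k) hw

theorem CondSigma.tendsto {σ : Rn n → Hist h n → ℝ} (hσ : CondSigma σ) (hα : 0 < α)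
    (hws : ∀ k, (z, ws k) ∈ P α) (hw : (z, w) ∈ P α)
    (hlim : ∀ ξ ∈ Ico (-h) (0 : ℝ), Tendsto (fun k => ext (ws k) ξ) atTop (𝓝 (ext w ξ))) :
    Tendsto (fun k => σ z (ws k)) atTop (𝓝 (σ z w)) := by
  obtain ⟨lam, -, hlam⟩ := hσ α hα
  rw [tendsto_iff_dist_tendsto_zero]
  have h1 := (tendsto_norm1_sub (zs := fun _ => z) hws hw hlim).const_mul lam
  rw [mul_zero] at h1
  refine squeeze_zero (fun _ => dist_nonneg) (fun k => ?_) h1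
  rw [Real.dist_eq]
  simpa using hlam _ _ _ _ (hws k) hw

end Convergence

theorem CondG.tendsto {ϑ t : ℝ} {g : ℝ → Rn n → Rn n} (hg : CondG ϑ g) (ht : t ∈ Icc 0 ϑ)
    {u : ℕ → Rn n} {v : Rn n} (hu : Tendsto u atTop (𝓝 v)) :
    Tendsto (fun k => g t (u k)) atTop (𝓝 (g t v)) := by
  have h1 : Continuous fun u : Rn n => g t u :=
    hg.continuousOn.comp_continuous (f := fun u : Rn n => (t, u)) (by fun_prop)
      fun u => ⟨ht, mem_univ _⟩
  exact (h1.tendsto v).comp hu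

section Trajectories
variable {h ϑ τ t M : ℝ} {x : ℝ → Rn n} {xs : ℕ → ℝ → Rn n}

theorem tendsto_omega {g : ℝ → Rn n → Rn n} {H : ℝ → Rn n → Rn n → Rn n → ℝ} (hH : CondH1 ϑ H)
    (hh : 0 ≤ h) (h0 : 0 ≤ τ) (hτt : τ ≤ t) (htϑ : t ≤ ϑ)
    (hxs : ∀ k, PiecewiseLip (τ - h) ϑ (xs k))
    (hM : ∀ k, ∀ ξ ∈ Icc (τ - h) t, ‖xs k ξ‖ ≤ M)
    (hlim : ∀ ξ ∈ Icc (τ - h) t, Tendsto (fun k => xs k ξ) atTop (𝓝 (x ξ)))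
    (hy : ∀ ξ ∈ Icc τ t, Tendsto (fun k => neutral h g (xs k) ξ) atTop (𝓝 (neutral h g x ξ)))
    (s : Rn n) :
    Tendsto (fun k => omega h g H τ t (xs k) s) atTop (𝓝 (omega h g H τ t x s)) := by
  unfold omega
  refine Tendsto.sub ?_ ?_
  · obtain ⟨C, hC⟩ := hH.exists_bound M s
    refine intervalIntegral.tendsto_integral_filter_of_dominated_convergence (fun _ => C)
      (Eventually.of_forall fun k => ?_) (Eventually.of_forall fun k => ?_) (by simp) ?_
    · have h1 := hH.intervalIntegrable hh h0 (hτt.trans htϑ) (hxs k) s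
      have h2 : IntervalIntegrable (fun u => H u (xs k u) (xs k (u - h)) s) volume τ t := by
        refine h1.mono_set ?_
        rw [uIcc_of_le hτt, uIcc_of_le (hτt.trans htϑ)]
        exact Icc_subset_Icc_right htϑ
      exact (intervalIntegrable_iff.1 h2).aestronglyMeasurable
    · refine Eventually.of_forall fun u hu => ?_
      rw [uIoc_of_le hτt] at hu
      exact hC u ⟨h0.trans hu.1.le, hu.2.trans htϑ⟩ _ _
        (hM k u ⟨by linarith [hu.1], hu.2⟩) (hM k (u - h) ⟨by linarith [hu.1], by linarith [hu.2]⟩)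
    · refine Eventually.of_forall fun u hu => ?_
      rw [uIoc_of_le hτt] at hu
      have hmem : (u, x u, x (u - h), s) ∈
          Icc 0 ϑ ×ˢ (univ : Set (Rn n × Rn n × Rn n)) :=
        ⟨⟨h0.trans hu.1.le, hu.2.trans htϑ⟩, mem_univ _⟩
      have hc := hH _ hmem
      have hp : Tendsto (fun k => ((u, xs k u, xs k (u - h), s) : ℝ × Rn n × Rn n × Rn n)) atTop
          (𝓝[Icc 0 ϑ ×ˢ univ] (u, x u, x (u - h), s)) := by
        refine tendsto_nhdsWithin_iff.2 ⟨?_, Eventually.of_forall fun k => ⟨hmem.1, mem_univ _⟩⟩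
        refine tendsto_const_nhds.prodMk_nhds
          ((hlim u ⟨by linarith [hu.1], hu.2⟩).prodMk_nhds
            ((hlim (u - h) ⟨by linarith [hu.1], by linarith [hu.2]⟩).prodMk_nhds
              tendsto_const_nhds))
      exact hc.tendsto.comp hp
  · exact ((hy t ⟨hτt, le_rfl⟩).sub (hy τ ⟨le_rfl, hτt⟩)).inner tendsto_const_nhds

theorem tendsto_integral_rate {cH : ℝ} {η : ℕ → ℝ} (hcH : 0 ≤ cH) (hη : ∀ k, η k ∈ Icc (0 : ℝ) 1)
    (hη0 : Tendsto η atTop (𝓝 0)) (hh : 0 ≤ h) (hτϑ : τ ≤ ϑ)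
    (hxs : ∀ k, PiecewiseLip (τ - h) ϑ (xs k))
    (hM : ∀ k, ∀ ξ ∈ Icc (τ - h) t, ‖xs k ξ‖ ≤ M)
    (hlim : ∀ ξ ∈ Icc (τ - h) t, Tendsto (fun k => xs k ξ) atTop (𝓝 (x ξ)))
    {a b : ℝ} (ha : τ ≤ a) (hab : a ≤ b) (hbt : b ≤ t) (htϑ : t ≤ ϑ) :
    Tendsto (fun k => ∫ u in a..b, rate h cH (η k) (xs k) u) atTop
      (𝓝 (∫ u in a..b, rate h cH 0 x u)) := by
  refine intervalIntegral.tendsto_integral_filter_of_dominated_convergence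
    (fun _ => cH * (1 + M + M) + 1)
    (Eventually.of_forall fun k => ?_) (Eventually.of_forall fun k => ?_) (by simp) ?_
  · have h2 : IntervalIntegrable (rate h cH (η k) (xs k)) volume a b := by
      refine ((hxs k).intervalIntegrable_rate hh hτϑ hcH (hη k).1).mono_set ?_
      rw [uIcc_of_le hab, uIcc_of_le hτϑ]
      exact Icc_subset_Icc ha (hbt.trans htϑ)
    exact (intervalIntegrable_iff.1 h2).aestronglyMeasurable
  · refine Eventually.of_forall fun u hu => ?_
    rw [uIoc_of_le hab] at hu
    rw [Real.norm_of_nonneg (rate_nonneg hcH (hη k).1 _ _)]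
    have h1 := hM k u ⟨by linarith [hu.1], hu.2.trans hbt⟩
    have h2 := hM k (u - h) ⟨by linarith [hu.1], by linarith [hu.2]⟩
    have h3 := (hη k).2
    unfold rate
    gcongr
  · refine Eventually.of_forall fun u hu => ?_
    rw [uIoc_of_le hab] at hu
    have h1 := hlim u ⟨by linarith [hu.1], hu.2.trans hbt⟩
    have h2 := hlim (u - h) ⟨by linarith [hu.1], by linarith [hu.2]⟩
    exact ((((h1.norm.const_add 1).add h2.norm).const_mul cH).add hη0)

end Trajectories

/-! ### Gronwall and Arzelà–Ascoli -/

/-- Gronwall's inequality in integral form. -/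
theorem le_gronwallBound_of_le_integral {f : ℝ → ℝ} {a b A B : ℝ} (hab : a ≤ b) (hA : 0 ≤ A)
    (hB : 0 ≤ B) (hf : ContinuousOn f (Icc a b)) (hf0 : ∀ t ∈ Icc a b, 0 ≤ f t)
    (hint : ∀ t ∈ Icc a b, f t ≤ ∫ u in a..t, (A + B * f u)) :
    ∀ t ∈ Icc a b, f t ≤ gronwallBound 0 B A (t - a) := by
  set F : ℝ → ℝ := IccExtend hab (domRestrict (Icc a b) f) with hF
  have hFc : Continuous F := hf.domRestrict.Icc_extend'
  have hFf : ∀ t ∈ Icc a b, F t = f t := fun t ht => IccExtend_of_mem hab _ ht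
  have hc : Continuous fun u => A + B * F u := by fun_prop
  set G : ℝ → ℝ := fun t => ∫ u in a..t, (A + B * F u) with hG
  have hfG : ∀ t ∈ Icc a b, f t ≤ G t := by
    intro t ht
    refine (hint t ht).trans_eq (intervalIntegral.integral_congr fun u hu => ?_)
    rw [uIcc_of_le ht.1] at hu
    simp only [hFf u ⟨hu.1, hu.2.trans ht.2⟩]
  have hder : ∀ t, HasDerivAt G (A + B * F t) t := fun t =>
    (hc.integral_hasStrictDerivAt a t).hasDerivAt
  intro t ht
  refine (hfG t ht).trans ((le_abs_self _).trans ?_)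
  rw [← Real.norm_eq_abs]
  refine norm_le_gronwallBound_of_norm_deriv_right_le (f' := fun t => A + B * F t)
    (continuousOn_of_forall_continuousAt fun t _ => (hder t).continuousAt)
    (fun t _ => (hder t).hasDerivWithinAt) (by simp [hG]) (fun u hu => ?_) t ht
  have hu' : u ∈ Icc a b := Ico_subset_Icc_self hu
  have h1 := hf0 u hu'
  have h2 := hfG u hu'
  rw [hFf u hu', Real.norm_of_nonneg (by positivity), Real.norm_of_nonneg (h1.trans h2)]
  nlinarith

/-- Arzelà–Ascoli for equi-Lipschitz sequences; the limit is constant to the right of `b`. -/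
theorem exists_subseq_tendsto_of_lipschitz {a b R : ℝ} (hab : a ≤ b) {K : NNReal}
    {ys : ℕ → ℝ → Rn n} (hK : ∀ k, LipschitzOnWith K (ys k) (Icc a b))
    (hR : ∀ k, ∀ t ∈ Icc a b, ‖ys k t‖ ≤ R) :
    ∃ (y : ℝ → Rn n) (ψ : ℕ → ℕ), StrictMono ψ ∧ LipschitzWith K y ∧ (∀ t, b ≤ t → y t = y b) ∧
      ∀ t ∈ Icc a b, Tendsto (fun k => ys (ψ k) t) atTop (𝓝 (y t)) := by
  set A : Set (BoundedContinuousFunction (Icc a b) (Rn n)) :=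
    {f | LipschitzWith K f ∧ ∀ t, f t ∈ Metric.closedBall (0 : Rn n) R} with hA
  have hcomp : IsCompact (closure A) := by
    refine BoundedContinuousFunction.arzela_ascoli _ (isCompact_closedBall (0 : Rn n) R) A
      (fun f t hf => hf.2 t) ?_
    exact (LipschitzWith.uniformEquicontinuous _ K fun f : A => f.2.1).equicontinuous
  set F : ℕ → BoundedContinuousFunction (Icc a b) (Rn n) := fun k =>
    BoundedContinuousFunction.mkOfCompact
      ⟨domRestrict (Icc a b) (ys k), (hK k).to_restrict.continuous⟩ with hF
  have hFA : ∀ k, F k ∈ A := fun k => ⟨(hK k).to_restrict, fun t =>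
    mem_closedBall_zero_iff.2 (hR k t t.2)⟩
  obtain ⟨f, -, ψ, hψ, hlim⟩ := hcomp.tendsto_subseq fun k => subset_closure (hFA k)
  have hpt : ∀ t, Tendsto (fun k => F (ψ k) t) atTop (𝓝 (f t)) := fun t =>
    (BoundedContinuousFunction.lipschitz_eval_const t).continuous.continuousAt.tendsto.comp hlim
  have hfK : LipschitzWith K f := by
    refine LipschitzWith.of_dist_le_mul fun s t => ?_
    exact le_of_tendsto' ((hpt s).dist (hpt t)) fun k => (hFA (ψ k)).1.dist_le_mul s t
  refine ⟨IccExtend hab f, ψ, hψ, ?_, fun t ht => ?_, fun t ht => ?_⟩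
  · have := hfK.comp (LipschitzWith.projIcc hab)
    rwa [mul_one] at this
  · rw [IccExtend_of_right_le hab _ ht, IccExtend_right]
  · rw [IccExtend_of_mem hab _ ht]
    exact hpt ⟨t, ht⟩

/-! ### Compactness of trajectories over one delay interval -/

section OneStep
variable {h ϑ cH α τ t : ℝ} {g : ℝ → Rn n → Rn n} {z : Rn n}

/-- A priori bounds, uniform over initial data in `P α` and `η ∈ [0, 1]`, up to time `τ + h`: there
the delayed argument only sees the initial data, and Gronwall's inequality applies to `y`. -/
theorem exists_uniform_bounds (hg : CondG ϑ g) (hh : 0 < h) (hcH : 0 ≤ cH) (hα : 0 ≤ α)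
    (h0 : 0 ≤ τ) (hτt : τ ≤ t) (htϑ : t ≤ ϑ) (hth : t ≤ τ + h) :
    ∃ (M R : ℝ) (K : NNReal), ∀ η ∈ Icc (0 : ℝ) 1, ∀ (w : Hist h n), (z, w) ∈ P α →
      ∀ x ∈ X ϑ cH g η τ z w, (∀ ξ ∈ Icc (τ - h) t, ‖x ξ‖ ≤ M) ∧
        (∀ ξ ∈ Icc τ t, ‖neutral h g x ξ‖ ≤ R) ∧
        LipschitzOnWith K (neutral h g x) (Icc τ t) := by
  have hcomp : IsCompact (Icc 0 ϑ ×ˢ Metric.closedBall (0 : Rn n) α) :=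
    isCompact_Icc.prod (isCompact_closedBall _ _)
  obtain ⟨Mg, hMg⟩ := hcomp.exists_bound_of_continuousOn
    (hg.continuousOn.mono (prod_mono_right (subset_univ _)))
  have hMg' : ∀ ξ ∈ Icc τ t, ∀ u : Rn n, ‖u‖ ≤ α → ‖g ξ u‖ ≤ Mg := fun ξ hξ u hu =>
    hMg (ξ, u) ⟨⟨h0.trans hξ.1, hξ.2.trans htϑ⟩, by simpa using hu⟩
  have hMg0 : 0 ≤ Mg :=
    (norm_nonneg _).trans (hMg' τ ⟨le_rfl, hτt⟩ 0 (by simpa using hα))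
  set A : ℝ := cH * (1 + (α + 2 * Mg) + α) + 1 with hA
  have hA0 : 0 ≤ A := by positivity
  set B : ℝ := gronwallBound 0 cH A (t - τ) with hB
  refine ⟨α + (B + α + 2 * Mg), B + α + Mg, (A + cH * B).toNNReal, ?_⟩
  rintro η hη w ⟨hw, hzα, hwα⟩ x hx
  simp only at hw hzα hwα
  have hτϑ : τ ≤ ϑ := hτt.trans htϑ
  rw [mem_X_iff hh.le hcH hη.1 hτϑ] at hx
  obtain ⟨hL, hy⟩ := hx
  have hpast : ∀ ξ ∈ Icc (τ - h) τ, ‖x ξ‖ ≤ α := by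
    intro ξ hξ
    rcases hξ.2.lt_or_eq with h1 | rfl
    · rw [Lam_apply_of_lt hL hξ.1 h1, show ext w (ξ - τ) = w ⟨ξ - τ, by
        constructor <;> linarith [hξ.1]⟩ from ext_apply _ ⟨ξ - τ, _⟩]
      exact hwα _
    · rwa [hL.2.1]
  have hdelay : ∀ ξ ∈ Icc τ t, ‖x (ξ - h)‖ ≤ α := fun ξ hξ =>
    hpast _ ⟨by linarith [hξ.1], by linarith [hξ.2]⟩
  have hyτ : ‖neutral h g x τ‖ ≤ α + Mg := by
    rw [neutral, hL.2.1]
    exact (norm_sub_le _ _).trans (add_le_add hzα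
      (hMg' τ ⟨le_rfl, hτt⟩ _ (hdelay τ ⟨le_rfl, hτt⟩)))
  -- The increment of `y` obeys `f ξ ≤ ∫ (A + cH f)`, to which Gronwall's inequality applies.
  set f : ℝ → ℝ := fun ξ => ‖neutral h g x ξ - neutral h g x τ‖ with hf
  have hyf : ∀ ξ, ‖neutral h g x ξ‖ ≤ f ξ + α + Mg := by
    intro ξ
    have := norm_le_norm_add_norm_sub' (neutral h g x ξ) (neutral h g x τ)
    simp only [hf]
    linarith
  have hxf : ∀ ξ ∈ Icc τ t, ‖x ξ‖ ≤ f ξ + (α + 2 * Mg) := by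
    intro ξ hξ
    have h1 : x ξ = neutral h g x ξ + g ξ (x (ξ - h)) := by rw [neutral, sub_add_cancel]
    have h2 := norm_add_le (neutral h g x ξ) (g ξ (x (ξ - h)))
    rw [← h1] at h2
    linarith [hyf ξ, hMg' ξ hξ _ (hdelay ξ hξ)]
  have hrate : ∀ ξ ∈ Icc τ t, rate h cH η x ξ ≤ A + cH * f ξ := by
    intro ξ hξ
    have h1 := hxf ξ hξ
    have h2 := hdelay ξ hξ
    have h3 : cH * (1 + ‖x ξ‖ + ‖x (ξ - h)‖) ≤ cH * (1 + (f ξ + (α + 2 * Mg)) + α) := by gcongr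
    rw [rate, hA]
    linarith [hη.2]
  have hρ : IntervalIntegrable (rate h cH η x) volume τ t := by
    refine (hL.1.intervalIntegrable_rate hh.le hτϑ hcH hη.1).mono_set ?_
    rw [uIcc_of_le hτt, uIcc_of_le hτϑ]
    exact Icc_subset_Icc_right htϑ
  have hfc : ContinuousOn f (Icc τ t) := by
    obtain ⟨C, hC⟩ := hL.1.exists_rate_bound hh.le hcH η
    have h1 := (lipschitzOnWith_of_norm_sub_le_integral
      (hL.1.intervalIntegrable_rate hh.le hτϑ hcH hη.1) hC hy).continuousOn
    exact ((h1.mono (Icc_subset_Icc_right htϑ)).sub continuousOn_const).norm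
  have hfB : ∀ ξ ∈ Icc τ t, f ξ ≤ B := by
    intro ξ hξ
    have h1 := le_gronwallBound_of_le_integral hτt hA0 hcH hfc (fun _ _ => norm_nonneg _)
      (fun r hr => (hy τ r le_rfl hr.1 (hr.2.trans htϑ)).trans ?_) ξ hξ
    · exact h1.trans (gronwallBound_mono le_rfl hA0 hcH (by linarith [hξ.2]))
    · refine intervalIntegral.integral_mono_on hr.1 (hρ.mono_set ?_) ?_
        fun u hu => hrate u ⟨hu.1, hu.2.trans hr.2⟩
      · rw [uIcc_of_le hr.1, uIcc_of_le hτt]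
        exact Icc_subset_Icc_right hr.2
      · refine ContinuousOn.intervalIntegrable ?_
        rw [uIcc_of_le hr.1]
        exact continuousOn_const.add
          (continuousOn_const.mul (hfc.mono (Icc_subset_Icc_right hr.2)))
  have hB0 : 0 ≤ B := (norm_nonneg _).trans (hfB τ ⟨le_rfl, hτt⟩)
  refine ⟨fun ξ hξ => ?_, fun ξ hξ => ?_, ?_⟩
  · rcases le_total ξ τ with h1 | h1
    · exact (hpast ξ ⟨hξ.1, h1⟩).trans (by linarith)
    · exact (hxf ξ ⟨h1, hξ.2⟩).trans (by linarith [hfB ξ ⟨h1, hξ.2⟩])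
  · linarith [hyf ξ, hfB ξ hξ]
  · refine lipschitzOnWith_of_norm_sub_le_integral hρ (fun u hu => ?_)
      fun s r hs hsr hr => hy s r hs hsr (hr.trans htϑ)
    have hu' : u ∈ Icc τ t := Ico_subset_Icc_self hu
    have h1 := hfB u hu'
    exact (hrate u hu').trans (by gcongr)

/-- Compactness: trajectories `xs k ∈ X^{η k}` with `η k → 0`, starting from the same `z` and from
histories converging boundedly pointwise, subconverge pointwise up to time `τ + h`
to a trajectory in `X^0`. -/
theorem exists_subseq_limit (hg : CondG ϑ g) (hh : 0 < h) (hcH : 0 ≤ cH) (hα : 0 ≤ α)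
    (h0 : 0 ≤ τ) (hτt : τ ≤ t) (htϑ : t ≤ ϑ) (hth : t ≤ τ + h) {w : Hist h n} (hw : (z, w) ∈ P α)
    {ws : ℕ → Hist h n} (hws : ∀ k, (z, ws k) ∈ P α)
    (hlim : ∀ ξ ∈ Ico (-h) (0 : ℝ), Tendsto (fun k => ext (ws k) ξ) atTop (𝓝 (ext w ξ)))
    {η : ℕ → ℝ} (hη : ∀ k, η k ∈ Icc (0 : ℝ) 1) (hη0 : Tendsto η atTop (𝓝 0))
    {xs : ℕ → ℝ → Rn n} (hxs : ∀ k, xs k ∈ X ϑ cH g (η k) τ z (ws k)) :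
    ∃ x ∈ X ϑ cH g 0 τ z w, ∃ ψ : ℕ → ℕ, StrictMono ψ ∧ ∃ M : ℝ,
      (∀ k, ∀ ξ ∈ Icc (τ - h) t, ‖xs k ξ‖ ≤ M) ∧
      (∀ ξ ∈ Icc (τ - h) t, Tendsto (fun k => xs (ψ k) ξ) atTop (𝓝 (x ξ))) ∧
      ∀ ξ ∈ Icc τ t, Tendsto (fun k => neutral h g (xs (ψ k)) ξ) atTop (𝓝 (neutral h g x ξ)) := by
  have hτϑ : τ ≤ ϑ := hτt.trans htϑ
  obtain ⟨M, R, K, hb⟩ := exists_uniform_bounds (z := z) hg hh hcH hα h0 hτt htϑ hth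
  have hb' := fun k => hb (η k) (hη k) (ws k) (hws k) (xs k) (hxs k)
  obtain ⟨y, ψ, hψ, hyK, hyt, hylim⟩ := exists_subseq_tendsto_of_lipschitz hτt
    (fun k => (hb' k).2.2) (fun k => (hb' k).2.1)
  have hyτ : y τ = z - g τ (ext w (-h)) := by
    refine tendsto_nhds_unique (hylim τ ⟨le_rfl, hτt⟩) ?_
    have h1 : ∀ k, neutral h g (xs (ψ k)) τ = z - g τ (ext (ws (ψ k)) (-h)) := by
      intro k
      rw [neutral, (hxs (ψ k)).1.2.1, Lam_apply_of_lt (hxs (ψ k)).1 le_rfl (by linarith),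
        show τ - h - τ = -h by ring]
    simp only [h1]
    exact tendsto_const_nhds.sub (hg.tendsto ⟨h0, hτϑ⟩
      ((hlim (-h) ⟨le_rfl, by linarith⟩).comp hψ.tendsto_atTop))
  -- Past `t` the limit `y` is constant, so the trajectory is continued with zero velocity of `y`.
  obtain ⟨x, hxL, hxy⟩ := exists_mem_Lam_neutral_eq hh h0 hτϑ hg hw.1 hyK.lipschitzOnWith hyτ
  have hpast : ∀ ξ ∈ Icc (τ - h) τ, Tendsto (fun k => xs (ψ k) ξ) atTop (𝓝 (x ξ)) := by
    intro ξ hξ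
    rcases hξ.2.lt_or_eq with h1 | rfl
    · rw [Lam_apply_of_lt hxL hξ.1 h1]
      simp only [fun k => Lam_apply_of_lt (hxs k).1 hξ.1 h1]
      exact (hlim (ξ - τ) ⟨by linarith [hξ.1], by linarith⟩).comp hψ.tendsto_atTop
    · rw [hxL.2.1]
      simp only [fun k => (hxs k).1.2.1]
      exact tendsto_const_nhds
  have hneutral : ∀ ξ ∈ Icc τ t,
      Tendsto (fun k => neutral h g (xs (ψ k)) ξ) atTop (𝓝 (neutral h g x ξ)) := by
    intro ξ hξ
    rw [hxy ξ hξ.1]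
    exact hylim ξ hξ
  have hall : ∀ ξ ∈ Icc (τ - h) t, Tendsto (fun k => xs (ψ k) ξ) atTop (𝓝 (x ξ)) := by
    intro ξ hξ
    rcases le_total ξ τ with h1 | h1
    · exact hpast ξ ⟨hξ.1, h1⟩
    have e : ∀ x' : ℝ → Rn n, x' ξ = neutral h g x' ξ + g ξ (x' (ξ - h)) := fun x' => by
      rw [neutral, sub_add_cancel]
    rw [e x]
    simp only [fun k => e (xs k)]
    exact (hneutral ξ ⟨h1, hξ.2⟩).add (hg.tendsto ⟨h0.trans h1, hξ.2.trans htϑ⟩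
      (hpast (ξ - h) ⟨by linarith, by linarith [hξ.2]⟩))
  have hinc : ∀ s r, τ ≤ s → s ≤ r → r ≤ t →
      ‖neutral h g x r - neutral h g x s‖ ≤ ∫ u in s..r, rate h cH 0 x u := by
    intro s r hs hsr hr
    refine le_of_tendsto_of_tendsto'
      ((hneutral r ⟨hs.trans hsr, hr⟩).sub (hneutral s ⟨hs, hsr.trans hr⟩)).norm
      (tendsto_integral_rate (η := fun k => η (ψ k)) (xs := fun k => xs (ψ k)) hcH
        (fun k => hη (ψ k)) (hη0.comp hψ.tendsto_atTop) hh.le hτϑ (fun k => (hxs (ψ k)).1.1)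
        (fun k => (hb' (ψ k)).1) hall hs hsr hr htϑ) fun k => ?_
    exact ((mem_X_iff hh.le hcH (hη (ψ k)).1 hτϑ).1 (hxs (ψ k))).2 s r hs hsr (hr.trans htϑ)
  refine ⟨x, (mem_X_iff hh.le hcH le_rfl hτϑ).2 ⟨hxL, fun s r hs hsr hr => ?_⟩, ψ, hψ, M,
    fun k => (hb' k).1, hall, hneutral⟩
  rcases le_total r t with h1 | h1
  · exact hinc s r hs hsr h1
  have hconst : ∀ u, t ≤ u → neutral h g x u = y t := fun u hu => by
    rw [hxy u (hτt.trans hu), hyt u hu]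
  have hnn : ∀ a b, a ≤ b → 0 ≤ ∫ u in a..b, rate h cH 0 x u := fun a b hab =>
    intervalIntegral.integral_nonneg hab fun u _ => rate_nonneg hcH le_rfl x u
  rcases le_total t s with h2 | h2
  · rw [hconst r h1, hconst s h2, sub_self, norm_zero]
    exact hnn s r hsr
  · have hi : ∀ a b, τ ≤ a → a ≤ b → b ≤ ϑ →
        IntervalIntegrable (rate h cH 0 x) volume a b := by
      intro a b ha hab hb
      refine (hxL.1.intervalIntegrable_rate hh.le hτϑ hcH le_rfl).mono_set ?_
      rw [uIcc_of_le hab, uIcc_of_le hτϑ]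
      exact Icc_subset_Icc ha hb
    rw [← intervalIntegral.integral_add_adjacent_intervals (hi s t hs h2 htϑ) (hi t r hτt h1 hr),
      hconst r h1, ← hconst t le_rfl]
    linarith [hinc s t hs h2 le_rfl, hnn t r h1]

end OneStep

/-! ### From `C¹` histories to piecewise Lipschitz histories -/

section Inequalities
variable {h ϑ cH : ℝ} {N : ℕ} {g : ℝ → Rn n → Rn n} {H : ℝ → Rn n → Rn n → Rn n → ℝ}
  {φ : ℝ → Rn n → Hist h n → ℝ}

/-- Both inequalities are treated at once: `c = 1` gives the upper one, `c = -1` the lower one, for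
the value `φ(t, x(t), x_t) + ω(τ, t, x, s)` along some trajectory `x`. -/
theorem exists_trajectory_of_C1 (hg : CondG ϑ g) (hH : CondH1 ϑ H) (hφ : CondPhi2 N ϑ φ)
    (hh : 0 < h) (hcH : 0 ≤ cH) (hN : ϑ = N * h) (c : ℝ) {τ t : ℝ} (h0 : 0 ≤ τ) (hτt : τ ≤ t)
    (htϑ : t ≤ ϑ) (hth : t ≤ τ + h) (s z : Rn n) {w : Hist h n} (hw : w ∈ PLip)
    (hC1 : ∀ v ∈ C1, endLim v = z → ∀ η ∈ Ioc (0 : ℝ) 1, ∀ δ > 0, ∃ x ∈ X ϑ cH g η τ z v,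
      c * (φ t (x t) (seg h x t) + omega h g H τ t x s) ≤ c * φ τ z v + δ) :
    ∃ x ∈ X ϑ cH g 0 τ z w,
      c * (φ t (x t) (seg h x t) + omega h g H τ t x s) ≤ c * φ τ z w := by
  obtain ⟨α, hα, hzw⟩ := exists_mem_P z hw
  obtain ⟨v, hv, hvlim⟩ := exists_C1_approx hh hzw
  set η : ℕ → ℝ := fun k => 1 / ((k : ℝ) + 1) with hη
  have hη0 : Tendsto η atTop (𝓝 0) := tendsto_one_div_add_atTop_nhds_zero_nat
  have hηpos : ∀ k, 0 < η k := fun k => Nat.one_div_pos_of_nat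
  have hη1 : ∀ k, η k ≤ 1 := by
    intro k
    have : η k ≤ 1 / (((0 : ℕ) : ℝ) + 1) := Nat.one_div_le_one_div (Nat.zero_le k)
    simpa using this
  choose xs hxs hJ using fun k =>
    hC1 (v k) (hv k).1 (hv k).2.1 (η k) ⟨hηpos k, hη1 k⟩ (η k) (hηpos k)
  obtain ⟨x, hx, ψ, hψ, M, hM, hxlim, hylim⟩ := exists_subseq_limit hg hh hcH hα.le h0 hτt htϑ hth
    hzw (fun k => (hv k).2.2) hvlim (fun k => ⟨(hηpos k).le, hη1 k⟩) hη0 hxs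
  refine ⟨x, hx, ?_⟩
  have hψt := hψ.tendsto_atTop
  have hMx : ∀ ξ ∈ Icc (τ - h) t, ‖x ξ‖ ≤ M := fun ξ hξ =>
    le_of_tendsto' (hxlim ξ hξ).norm fun k => hM (ψ k) ξ hξ
  have ht : t ∈ Icc (τ - h) t := ⟨by linarith, le_rfl⟩
  have hseg : ∀ ξ ∈ Ico (-h) (0 : ℝ), t + ξ ∈ Icc (τ - h) t := fun ξ hξ =>
    ⟨by linarith [hξ.1], by linarith [hξ.2]⟩
  have hmemP : ∀ (η' : ℝ) (w' : Hist h n) (x' : ℝ → Rn n), x' ∈ X ϑ cH g η' τ z w' →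
      (∀ ξ ∈ Icc (τ - h) t, ‖x' ξ‖ ≤ M) → (x' t, seg h x' t) ∈ P (max 1 M) :=
    fun η' w' x' hx' hM' => ⟨seg_mem_PLip hx'.1 hh.le hτt htϑ, (hM' t ht).trans (le_max_right _ _),
      fun ξ => (hM' _ (hseg ξ ξ.2)).trans (le_max_right _ _)⟩
  have l1 : Tendsto (fun k => φ t (xs (ψ k) t) (seg h (xs (ψ k)) t)) atTop
      (𝓝 (φ t (x t) (seg h x t))) := by
    refine hφ.tendsto hh hN ⟨h0.trans hτt, htϑ⟩ (lt_of_lt_of_le one_pos (le_max_left 1 M))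
      (fun k => hmemP _ _ _ (hxs (ψ k)) (hM (ψ k))) (hmemP _ _ _ hx hMx) (hxlim t ht)
      fun ξ hξ => ?_
    simp only [ext_seg _ t hξ]
    exact hxlim _ (hseg ξ hξ)
  have l2 : Tendsto (fun k => omega h g H τ t (xs (ψ k)) s) atTop (𝓝 (omega h g H τ t x s)) :=
    tendsto_omega hH hh.le h0 hτt htϑ (fun k => (hxs (ψ k)).1.1) (fun k => hM (ψ k)) hxlim hylim s
  have l3 : Tendsto (fun k => φ τ z (v (ψ k))) atTop (𝓝 (φ τ z w)) :=
    hφ.tendsto hh hN ⟨h0, hτt.trans htϑ⟩ hα (fun k => (hv (ψ k)).2.2) hzw tendsto_const_nhds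
      fun ξ hξ => (hvlim ξ hξ).comp hψt
  have l4 := (l3.const_mul c).add (hη0.comp hψt)
  rw [add_zero] at l4
  exact le_of_tendsto_of_tendsto' ((l1.add l2).const_mul c) l4 fun k => hJ (ψ k)

/-- Trajectories that realize the inequality on single intervals `[ih, (i+1)h]` are concatenated:
`ω` is additive in time, so the inequality telescopes. -/
theorem exists_trajectory_of_one_step (hH : CondH1 ϑ H) (hh : 0 < h) (hcH : 0 ≤ cH)
    (hN : ϑ = N * h) (c : ℝ) (s : Rn n)
    (hstep : ∀ i < N, ∀ τ ∈ Ico (i * h) ((i + 1) * h), ∀ (z : Rn n), ∀ w ∈ PLip,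
      ∀ t ∈ Ioc τ ((i + 1) * h), ∃ x ∈ X ϑ cH g 0 τ z w,
        c * (φ t (x t) (seg h x t) + omega h g H τ t x s) ≤ c * φ τ z w)
    {τ : ℝ} (hτ : τ ∈ Ico 0 ϑ) (z : Rn n) {w : Hist h n} (hw : w ∈ PLip) {t : ℝ}
    (ht : t ∈ Ioc τ ϑ) :
    ∃ x ∈ X ϑ cH g 0 τ z w,
      c * (φ t (x t) (seg h x t) + omega h g H τ t x s) ≤ c * φ τ z w := by
  have key : ∀ m i : ℕ, i < N → ∀ τ ∈ Ico (i * h) ((i + 1) * h), ∀ (z : Rn n), ∀ w ∈ PLip,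
      ∀ t ∈ Ioc τ ϑ, t ≤ (i + 1 + m) * h → ∃ x ∈ X ϑ cH g 0 τ z w,
        c * (φ t (x t) (seg h x t) + omega h g H τ t x s) ≤ c * φ τ z w := by
    intro m
    induction m with
    | zero =>
      intro i hi τ hτ z w hw t ht htm
      exact hstep i hi τ hτ z w hw t ⟨ht.1, by simpa using htm⟩
    | succ m ih =>
      intro i hi τ hτ z w hw t ht htm
      rcases le_or_gt t ((i + 1) * h) with h1 | h1
      · exact hstep i hi τ hτ z w hw t ⟨ht.1, h1⟩
      have hih : 0 ≤ (i : ℝ) * h := by positivity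
      set τ₁ : ℝ := (i + 1) * h with hτ₁
      have hτ₁ϑ : τ₁ ≤ ϑ := h1.le.trans ht.2
      have hi1 : i + 1 < N := by
        have h2 : (i + 1) * h < N * h := by rw [← hN]; exact h1.trans_le ht.2
        exact_mod_cast lt_of_mul_lt_mul_right h2 hh.le
      obtain ⟨x₁, hx₁, hJ₁⟩ := hstep i hi τ hτ z w hw τ₁ ⟨hτ.2, le_rfl⟩
      obtain ⟨x₂, hx₂, hJ₂⟩ := ih (i + 1) hi1 τ₁
        ⟨by rw [hτ₁]; push_cast; exact le_rfl, by push_cast; linarith⟩ (x₁ τ₁) (seg h x₁ τ₁)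
        (seg_mem_PLip hx₁.1 hh.le hτ.2.le hτ₁ϑ) t ⟨h1, ht.2⟩
        (by push_cast at htm ⊢; linarith)
      obtain ⟨x, hx, hxe⟩ := exists_concat hH hh hcH le_rfl (hih.trans hτ.1) hτ.2.le hτ₁ϑ hx₁ hx₂
      obtain ⟨e1, e2, e3⟩ := hxe t ⟨h1.le, ht.2⟩
      refine ⟨x, hx, ?_⟩
      rw [e1, e2, e3 s]
      linarith
  have hfl : (⌊τ / h⌋₊ : ℝ) ≤ τ / h := Nat.floor_le (div_nonneg hτ.1 hh.le)
  have hfl' : τ / h < ⌊τ / h⌋₊ + 1 := Nat.lt_floor_add_one _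
  rw [le_div_iff₀ hh] at hfl
  rw [div_lt_iff₀ hh] at hfl'
  have hlt : ⌊τ / h⌋₊ < N := by
    rw [Nat.floor_lt (div_nonneg hτ.1 hh.le), div_lt_iff₀ hh, ← hN]
    exact hτ.2
  refine key N _ hlt τ ⟨hfl, hfl'⟩ z w hw t ht (ht.2.trans ?_)
  rw [hN]
  gcongr
  linarith [Nat.cast_nonneg (α := ℝ) ⌊τ / h⌋₊]

/-! ### The inequalities in the extended reals and the equivalence -/

theorem X_mono {η η' : ℝ} (hη : η ≤ η') (τ : ℝ) (z : Rn n) (w : Hist h n) :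
    X ϑ cH g η τ z w ⊆ X ϑ cH g η' τ z w := by
  rintro x ⟨hL, hK, hd⟩
  refine ⟨hL, hK, ?_⟩
  filter_upwards [hd] with t ht hmem
  obtain ⟨l, hl, hder⟩ := ht hmem
  have hl' : ‖l‖ ≤ cH * (1 + ‖x t‖ + ‖x (t - h)‖) + η := hl
  exact ⟨l, hl'.trans (by linarith), hder⟩

variable {η τ t : ℝ} {z s : Rn n} {w : Hist h n}

theorem UpperIneq.exists_lt (hU : UpperIneq ϑ cH g H φ η τ z w t s) {δ : ℝ} (hδ : 0 < δ) :
    ∃ x ∈ X ϑ cH g η τ z w,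
      φ t (x t) (seg h x t) + omega h g H τ t x s < φ τ z w + δ := by
  have h1 : ((φ τ z w : ℝ) : EReal) < ((φ τ z w + δ : ℝ) : EReal) :=
    EReal.coe_lt_coe_iff.2 (by linarith)
  obtain ⟨x, hx⟩ := iInf_lt_iff.1 (lt_of_le_of_lt hU h1)
  obtain ⟨hx1, hx2⟩ := iInf_lt_iff.1 hx
  exact ⟨x, hx1, EReal.coe_lt_coe_iff.1 hx2⟩

theorem LowerIneq.exists_lt (hU : LowerIneq ϑ cH g H φ η τ z w t s) {δ : ℝ} (hδ : 0 < δ) :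
    ∃ x ∈ X ϑ cH g η τ z w,
      φ τ z w - δ < φ t (x t) (seg h x t) + omega h g H τ t x s := by
  have h1 : ((φ τ z w - δ : ℝ) : EReal) < ((φ τ z w : ℝ) : EReal) :=
    EReal.coe_lt_coe_iff.2 (by linarith)
  obtain ⟨x, hx⟩ := lt_iSup_iff.1 (lt_of_lt_of_le h1 hU)
  obtain ⟨hx1, hx2⟩ := lt_iSup_iff.1 hx
  exact ⟨x, hx1, EReal.coe_lt_coe_iff.1 hx2⟩

theorem upperIneq_of_exists (hx : ∃ x ∈ X ϑ cH g η τ z w,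
    φ t (x t) (seg h x t) + omega h g H τ t x s ≤ φ τ z w) :
    UpperIneq ϑ cH g H φ η τ z w t s := by
  obtain ⟨x, hx, hle⟩ := hx
  exact iInf₂_le_of_le x hx (EReal.coe_le_coe_iff.2 hle)

theorem lowerIneq_of_exists (hx : ∃ x ∈ X ϑ cH g η τ z w,
    φ τ z w ≤ φ t (x t) (seg h x t) + omega h g H τ t x s) :
    LowerIneq ϑ cH g H φ η τ z w t s := by
  obtain ⟨x, hx, hle⟩ := hx
  exact le_iSup₂_of_le x hx (EReal.coe_le_coe_iff.2 hle)

theorem UpperIneq.mono {η' : ℝ} (hη : η ≤ η') (hU : UpperIneq ϑ cH g H φ η τ z w t s) :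
    UpperIneq ϑ cH g H φ η' τ z w t s :=
  (biInf_mono (X_mono hη τ z w)).trans hU

theorem LowerIneq.mono {η' : ℝ} (hη : η ≤ η') (hU : LowerIneq ϑ cH g H φ η τ z w t s) :
    LowerIneq ϑ cH g H φ η' τ z w t s :=
  hU.trans (biSup_mono (X_mono hη τ z w))

variable {σ : Rn n → Hist h n → ℝ}

theorem IsMinimaxSolution.isLipMinimaxSolution (hh : 0 < h)
    (hφ : IsMinimaxSolution N ϑ cH g H σ φ) : IsLipMinimaxSolution N ϑ cH g H σ φ where
  phi1 := hφ.phi1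
  phi2 := hφ.phi2
  terminal w hw := hφ.terminal _ w (mem_PLip_of_mem_Lip hh.le hw)
  ineq τ hτ w hw := hφ.ineq τ hτ _ w (mem_PLip_of_mem_Lip hh.le hw)

theorem IsLipMinimaxSolution.isC1MinimaxSolution (hh : 0 < h) (hN : ϑ = N * h)
    (hφ : IsLipMinimaxSolution N ϑ cH g H σ φ) : IsC1MinimaxSolution N ϑ cH g H σ φ where
  phi1 := hφ.phi1
  phi2 := hφ.phi2
  terminal w hw := hφ.terminal w hw.1
  ineq i hi τ hτ w hw t ht s η hη := by
    have h1 : ((i : ℝ) + 1) * h ≤ ϑ := by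
      rw [hN]
      have : ((i + 1 : ℕ) : ℝ) ≤ N := by exact_mod_cast hi
      push_cast at this
      gcongr
    have h2 : 0 ≤ (i : ℝ) * h := by positivity
    have h3 := hφ.ineq τ ⟨h2.trans hτ.1, hτ.2.trans_le h1⟩ w hw.1 t ⟨ht.1, ht.2.trans h1⟩ s
    exact ⟨h3.1.mono hη.1.le, h3.2.mono hη.1.le⟩

theorem IsC1MinimaxSolution.isMinimaxSolution (hg : CondG ϑ g) (hH : CondH1 ϑ H)
    (hσ : CondSigma σ) (hh : 0 < h) (hcH : 0 ≤ cH) (hN : ϑ = N * h)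
    (hφ : IsC1MinimaxSolution N ϑ cH g H σ φ) : IsMinimaxSolution N ϑ cH g H σ φ where
  phi1 := hφ.phi1
  phi2 := hφ.phi2
  terminal z w hw := by
    have hϑ : 0 ≤ ϑ := by rw [hN]; positivity
    obtain ⟨α, hα, hzw⟩ := exists_mem_P z hw
    obtain ⟨v, hv, hvlim⟩ := exists_C1_approx hh hzw
    refine tendsto_nhds_unique (hφ.phi2.tendsto hh hN ⟨hϑ, le_rfl⟩ hα (fun k => (hv k).2.2) hzw
      tendsto_const_nhds hvlim) ((hσ.tendsto hα (fun k => (hv k).2.2) hzw hvlim).congr fun k => ?_)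
    have := hφ.terminal (v k) (hv k).1
    rw [(hv k).2.1] at this
    exact this.symm
  ineq τ hτ z w hw t ht s := by
    have hsub : ∀ i < N, ((i : ℝ) + 1) * h ≤ ϑ := by
      intro i hi
      rw [hN]
      have : ((i + 1 : ℕ) : ℝ) ≤ N := by exact_mod_cast hi
      push_cast at this
      gcongr
    have key : ∀ c : ℝ, (∀ i < N, ∀ τ ∈ Ico (i * h) ((i + 1) * h), ∀ v ∈ C1,
        ∀ t ∈ Ioc τ ((i + 1) * h), ∀ η ∈ Ioc (0 : ℝ) 1, ∀ δ > 0,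
          ∃ x ∈ X ϑ cH g η τ (endLim v) v,
            c * (φ t (x t) (seg h x t) + omega h g H τ t x s) ≤ c * φ τ (endLim v) v + δ) →
        ∃ x ∈ X ϑ cH g 0 τ z w,
          c * (φ t (x t) (seg h x t) + omega h g H τ t x s) ≤ c * φ τ z w := by
      intro c hc
      refine exists_trajectory_of_one_step hH hh hcH hN c s ?_ hτ z hw ht
      intro i hi τ hτ z w hw t ht
      have h2 : 0 ≤ (i : ℝ) * h := by positivity
      refine exists_trajectory_of_C1 hg hH hφ.phi2 hh hcH hN c (h2.trans hτ.1) ht.1.le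
        (ht.2.trans (hsub i hi)) (by linarith [hτ.1, ht.2]) s z hw ?_
      rintro v hv rfl
      exact hc i hi τ hτ v hv t ht
    constructor
    · refine upperIneq_of_exists ?_
      simpa using key 1 fun i hi τ hτ v hv t ht η hη δ hδ => by
        obtain ⟨x, hx, hlt⟩ := (hφ.ineq i hi τ hτ v hv t ht s η hη).1.exists_lt hδ
        exact ⟨x, hx, by linarith⟩
    · refine lowerIneq_of_exists ?_
      -- The lower inequality is the upper one for the negated value.
      obtain ⟨x, hx, hle⟩ := key (-1) fun i hi τ hτ v hv t ht η hη δ hδ => by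
        obtain ⟨x, hx, hlt⟩ := (hφ.ineq i hi τ hτ v hv t ht s η hη).2.exists_lt hδ
        exact ⟨x, hx, by linarith⟩
      exact ⟨x, hx, by linarith⟩

end Inequalities

end NeutralHJ

theorem theorem3 (n N : ℕ) (h ϑ cH : ℝ) (hh : 0 < h) (hϑ : 0 < ϑ) (hN : ϑ = N * h)
    (g : ℝ → NeutralHJ.Rn n → NeutralHJ.Rn n)
    (H : ℝ → NeutralHJ.Rn n → NeutralHJ.Rn n → NeutralHJ.Rn n → ℝ)
    (σ : NeutralHJ.Rn n → NeutralHJ.Hist h n → ℝ)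
    (hg : NeutralHJ.CondG ϑ g) (hH1 : NeutralHJ.CondH1 ϑ H)
    (hcH : 0 < cH) (hH2 : NeutralHJ.CondH2 ϑ cH H) (hH3 : NeutralHJ.CondH3 ϑ H)
    (hσ : NeutralHJ.CondSigma σ)
    (φ : ℝ → NeutralHJ.Rn n → NeutralHJ.Hist h n → ℝ) :
    List.TFAE [NeutralHJ.IsMinimaxSolution N ϑ cH g H σ φ,
      NeutralHJ.IsLipMinimaxSolution N ϑ cH g H σ φ,
      NeutralHJ.IsC1MinimaxSolution N ϑ cH g H σ φ] := by
  tfae_have 1 → 2 := fun hφ => hφ.isLipMinimaxSolution hh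
  tfae_have 2 → 3 := fun hφ => hφ.isC1MinimaxSolution hh hN
  tfae_have 3 → 1 := fun hφ => hφ.isMinimaxSolution hg hH1 hσ hh hcH.le hN
  tfae_finish
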